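/- Let $p\ge 0$, let $h$ be a hermitian form of signature $(3,p)$ on a complex vector space $V\simeq\mathbb{C}^{3+p}$, and let $\Omega\subset\mathbb{P}(V)$ be the open set of lines on which $h$ is positive. Let $\omega:=i\Theta(\mathcal{O}_{\mathbb{P}(V)}(-1)|_\Omega,h)$, a pseudo-Kähler metric of signature $(p,2)$ on $\Omega$. Let $h_{FS}$ be a positive definite hermitian form on $V$ and let $\omega_{FS}$ be the associated Fubini–Study metric, i.e. the curvature form of the metric induced by $h_{FS}$ on $\mathcal{O}_{\mathbb{P}(V)}(1)$. Let $f:\mathbb{C}\to\Omega$ be a non-constant holomorphic map. For $z\in\mathbb{C}$ let $\mathcal{L}_z\subset T_{\Omega,f(z)}$ be the line spanned by $g(z)$, where near $z$ one writes $f'(w)=(w-z)^m g(w)$ with $m\ge 0$, $g$ a holomorphic section of $f^*T_\Omega$ and $g(z)\ne 0$. These lines form a holomorphic line subbundle $\mathcal{L}$ of $f^*T_\Omega$. Assume that $\omega$ is positive definite on $\mathcal{L}_z$ for every $z\in\mathbb{C}$. Let $\nabla$ be the Chern connection of $(f^*T_\Omega,f^*\omega)$, and let $\psi\in\mathrm{Hom}(\mathcal{L},\mathcal{L}^\perp)$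 be given by $\psi(s):=\mathrm{pr}_{\mathcal{L}^\perp}(\nabla_{\partial/\partial z}s)$, so that $\beta=\psi\otimes dz$ is the second fundamental form of $\mathcal{L}\subset f^*T_\Omega$; orthogonality is with respect to $\omega$. Put $$\sigma_f:=\|\psi\|^2_{f^*\omega}\,\tfrac{i}{2}\,dz\wedge d\bar z,\qquad T_{\sigma_f}(r):=\int_1^r\frac{dt}{t}\int_{\{|z|<t\}}\sigma_f\quad(r\ge 1),$$ where $\|\psi\|^2_{f^*\omega}=\omega(\psi x,\psi x)/\omega(x,x)$ for $0\ne x\in\mathcal{L}_z$ (a real number that may be negative, since $\omega$ is indefinite on $\mathcal{L}_z^\perp$). Assume that there exists $\varepsilon>0$ such that $f^*\omega\ge\varepsilon f^*\omega_{FS}$ on $\mathbb{C}$. Then the function $T_{\sigma_f}:[1,+\infty[\to\mathbb{R}$ is not bounded from below. -/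

import Mathlib

open Set Filter Topology MeasureTheory
open scoped LinearAlgebra.Projectivization

noncomputable section

namespace PeriodCurve

/-! ## Wirtinger derivatives -/

section Wirtinger

variable {E : Type*} [NormedAddCommGroup E] [NormedSpace ℂ E]

/-- The `(1,0)`-derivative `∂φ(x)(a) = (dφ(x)(a) - i dφ(x)(ia)) / 2`; it is `ℂ`-linear in `a`.
For `E = ℂ` and `a = 1` this is `∂φ/∂z`. -/
def del (φ : E → ℂ) (x a : E) : ℂ :=
  (fderiv ℝ φ x a - Complex.I * fderiv ℝ φ x (Complex.I • a)) / 2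

/-- The `(0,1)`-derivative `∂̄φ(x)(b) = (dφ(x)(b) + i dφ(x)(ib)) / 2`; it is antilinear in `b`. -/
def delBar (φ : E → ℂ) (x b : E) : ℂ :=
  (fderiv ℝ φ x b + Complex.I * fderiv ℝ φ x (Complex.I • b)) / 2

/-- The complex Hessian `∂∂̄φ(x)(a, b̄) = ∑ (∂²φ / ∂z_i ∂z̄_j)(x) a_i b̄_j`. -/
def complexHessian (φ : E → ℂ) (x a b : E) : ℂ :=
  del (fun y => delBar φ y b) x a

end Wirtinger

variable {V : Type*} [NormedAddCommGroup V] [NormedSpace ℂ V]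

/-! ## Hermitian forms and the domain of positive lines -/

/-- Sesquilinear forms on `V`, linear in the first and antilinear in the second variable. -/
abbrev SesqForm (V : Type*) [NormedAddCommGroup V] [NormedSpace ℂ V] : Type _ :=
  V →ₗ[ℂ] V →ₗ⋆[ℂ] ℂ

/-- `k` is a hermitian form. -/
def IsHermitianForm (k : SesqForm V) : Prop :=
  ∀ x y, (starRingEnd ℂ) (k x y) = k y x

/-- `k` is a positive definite hermitian form. -/
def IsPosDefHermitian (k : SesqForm V) : Prop :=
  IsHermitianForm k ∧ ∀ x, x ≠ 0 → 0 < (k x x).re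

/-- `k` is a hermitian form of signature `(m, p)` on `V` (hence `dim V = m + p`): there is an
orthogonal basis with `m` vectors of square `1` and `p` vectors of square `-1`. -/
def HasSignature (k : SesqForm V) (m p : ℕ) : Prop :=
  IsHermitianForm k ∧ ∃ b : Module.Basis (Fin m ⊕ Fin p) ℂ V,
    (∀ i, k (b (Sum.inl i)) (b (Sum.inl i)) = 1) ∧
    (∀ j, k (b (Sum.inr j)) (b (Sum.inr j)) = -1) ∧
    ∀ i j, i ≠ j → k (b i) (b j) = 0

/-- The domain `Ω ⊆ ℙ(V)` of the lines on which `h` is positive. -/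
def positiveDomain (h : SesqForm V) : Set (ℙ ℂ V) :=
  {l | ∀ v ∈ l.submodule, v ≠ 0 → 0 < (h v v).re}

/-- The tangent space of `ℙ(V)` at the line `l`, that is `Hom(l, V / l)`: the differential at
`v ∈ l \ {0}` of the projection `V \ {0} → ℙ(V)` sends `a` to the map with `v ↦ a mod l`. -/
abbrev Tan (l : ℙ ℂ V) : Type _ := l.submodule →ₗ[ℂ] V ⧸ l.submodule

lemma rep_mem (l : ℙ ℂ V) : l.rep ∈ l.submodule := by
  rw [l.submodule_eq]; exact Submodule.mem_span_singleton_self _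

/-- The curvature form `iΘ(𝒪(-1), k)` of the metric induced by the hermitian form `k` on the
tautological bundle, on the open set of the lines where `k` is positive, given by its hermitian
matrix: if `iΘ = ∑ g_{ij} (i/2) dz_i ∧ dz̄_j`, then this is `∑ g_{ij} u_i ū'_j`.

The tautological section `v ↦ v` trivializes the pullback of `𝒪(-1)` to `V \ {0}`, so that `iΘ`
pulls back to `-i∂∂̄ log k(v, v)`, with matrix `-2 ∂²(log k(v, v)) / ∂v_i ∂v̄_j`. It is evaluated
at the representative `v = l.rep` of `l`, on vectors `a, b` that represent `u(v), u'(v) ∈ V / l`.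
The value does not depend on the choice of `v`, `a` and `b`. -/
def tautCurvature (k : SesqForm V) (l : ℙ ℂ V) (u u' : Tan l) : ℂ :=
  -2 * complexHessian (fun v : V => ((Real.log (k v v).re : ℝ) : ℂ)) l.rep
    (Quotient.out (u ⟨l.rep, rep_mem l⟩)) (Quotient.out (u' ⟨l.rep, rep_mem l⟩))

/-- The pseudo-Kähler metric `ω = iΘ(𝒪(-1), h)` on the domain `Ω` of `h`-positive lines. -/
def omega (h : SesqForm V) (l : ℙ ℂ V) (u u' : Tan l) : ℂ :=
  tautCurvature h l u u'

/-- The Fubini-Study metric of a positive definite form: the curvature form of the induced metric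
on `𝒪(1)`, the dual of `𝒪(-1)`. -/
def omegaFS (hFS : SesqForm V) (l : ℙ ℂ V) (u u' : Tan l) : ℂ :=
  -tautCurvature hFS l u u'

/-! ## Entire curves and sections of `f^*T` -/

/-- `F` is a holomorphic lift of `f : ℂ → ℙ(V)` to `V \ {0}` in a neighbourhood of `z`. -/
def IsLiftAt (f : ℂ → ℙ ℂ V) (F : ℂ → V) (z : ℂ) : Prop :=
  AnalyticAt ℂ F z ∧ ∀ᶠ w in 𝓝 z, F w ≠ 0 ∧ F w ∈ (f w).submodule

/-- `f : ℂ → ℙ(V)` is holomorphic: locally, it has a holomorphic lift to `V \ {0}`. -/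
def IsHolomorphicCurve (f : ℂ → ℙ ℂ V) : Prop :=
  ∀ z, ∃ F, IsLiftAt f F z

/-- The section `s` of the pullback `f^*T` of the tangent bundle of `ℙ(V)` is holomorphic in a
neighbourhood of `z`: for some local lift `F` of `f`, the section `s(F)` of `V / f` is the class of
a holomorphic function with values in `V`. -/
def IsHolSectionAt (f : ℂ → ℙ ℂ V) (s : ∀ w, Tan (f w)) (z : ℂ) : Prop :=
  ∃ F A : ℂ → V, IsLiftAt f F z ∧ AnalyticAt ℂ A z ∧
    ∀ᶠ w in 𝓝 z, ∃ hF : F w ∈ (f w).submodule,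
      s w ⟨F w, hF⟩ = Submodule.Quotient.mk (A w)

/-- The derivative `f'(z) = df(∂/∂z)`: the tangent vector at `f(z)` that maps `F(z)` to the class
of `F'(z)`, for a local holomorphic lift `F` of `f`. -/
def velocity (f : ℂ → ℙ ℂ V) (z : ℂ) : Tan (f z) :=
  Classical.epsilon fun u => ∃ F, IsLiftAt f F z ∧ ∃ hF : F z ∈ (f z).submodule,
    u ⟨F z, hF⟩ = Submodule.Quotient.mk (deriv F z)

/-- `s` is, in a neighbourhood of `z`, a holomorphic section of the tautological line bundle
`ℒ = f'^*𝒪(-1) ⊆ f^*T` of the lift of `f` to the projectivized tangent bundle: a holomorphic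
section of `f^*T` that is proportional to `f'` near `z`, except maybe at `z` (if `f` is not
constant, `f'` has no zero near `z` except maybe `z`). -/
def IsLineSectionAt (f : ℂ → ℙ ℂ V) (s : ∀ w, Tan (f w)) (z : ℂ) : Prop :=
  IsHolSectionAt f s z ∧ ∀ᶠ w in 𝓝[≠] z, s w ∈ Submodule.span ℂ {velocity f w}

/-- The fibre `ℒ_z` of the tautological line bundle, that is, the line in the tangent space at
`f(z)` defined by the lift of `f` to the projectivized tangent bundle. It is spanned by `f'(z)` if
`f'(z) ≠ 0`, and by `g(z)` if `f' = (w - z)^m g` near `z` with `g(z) ≠ 0`. -/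
def tangentLine (f : ℂ → ℙ ℂ V) (z : ℂ) : Submodule ℂ (Tan (f z)) :=
  Submodule.span ℂ {x | ∃ s, IsLineSectionAt f s z ∧ s z = x}

/-- The lift of `f` to the projectivized tangent bundle takes its values in the set of the lines
on which `ω` is positive definite. -/
def IsTangentToPositive (h : SesqForm V) (f : ℂ → ℙ ℂ V) : Prop :=
  ∀ z, ∀ u ∈ tangentLine f z, u ≠ 0 → 0 < (omega h (f z) u u).re

/-! ## The second fundamental form -/

/-- The covariant derivative `∇_{∂/∂z} s` at `z` of a section `s` of `f^*T`, for the Chern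
connection of `(f^*T, f^*ω)`. Since `∇` is metric and `∇^{0,1} = ∂̄`, it is the vector `e` with
`ω(e, t(z)) = ∂/∂z ω(s, t)` for all local holomorphic sections `t`; this determines it because `ω`
is non-degenerate. -/
def chernDeriv (h : SesqForm V) (f : ℂ → ℙ ℂ V) (s : ∀ w, Tan (f w)) (z : ℂ) : Tan (f z) :=
  Classical.epsilon fun e => ∀ t, IsHolSectionAt f t z →
    omega h (f z) e (t z) = del (fun w => omega h (f w) (s w) (t w)) z 1

/-- The component in `ℒ_z^⊥` of a tangent vector `e` at `f(z)`, for the orthogonal decomposition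
`T = ℒ_z ⊕ ℒ_z^⊥` with respect to `ω`. -/
def normalPart (h : SesqForm V) (f : ℂ → ℙ ℂ V) (z : ℂ) (e : Tan (f z)) : Tan (f z) :=
  Classical.epsilon fun y => e - y ∈ tangentLine f z ∧
    ∀ x ∈ tangentLine f z, omega h (f z) y x = 0

/-- The second fundamental form `β = ψ ⊗ dz` of `ℒ ⊆ f^*T`: `ψ_z` maps `x ∈ ℒ_z` to the component
in `ℒ_z^⊥` of `∇_{∂/∂z} s`, for any local holomorphic section `s` of `ℒ` with `s(z) = x`. -/
def psi (h : SesqForm V) (f : ℂ → ℙ ℂ V) (z : ℂ) (x : Tan (f z)) : Tan (f z) :=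
  Classical.epsilon fun y => ∃ s, IsLineSectionAt f s z ∧ s z = x ∧
    y = normalPart h f z (chernDeriv h f s z)

/-- The squared norm `‖ψ_z‖²` for the metric induced by `ω` on `Hom(ℒ_z, ℒ_z^⊥)`: as `ℒ_z` is a
line, it is `ω(ψ_z x, ψ_z x) / ω(x, x)` for any non-zero `x ∈ ℒ_z`. It can be negative, because `ω`
is indefinite on `ℒ_z^⊥`. -/
def psiNormSq (h : SesqForm V) (f : ℂ → ℙ ℂ V) (z : ℂ) : ℝ :=
  Classical.epsilon fun c : ℝ => ∃ x ∈ tangentLine f z, x ≠ 0 ∧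
    c = (omega h (f z) (psi h f z x) (psi h f z x)).re / (omega h (f z) x x).re

/-! ## Characteristic functions -/

/-- The characteristic function `T_α(r) = ∫_1^r (dt / t) ∫_{|z| < t} α` of the `(1,1)`-form
`α = ρ (i/2) dz ∧ dz̄`; here `(i/2) dz ∧ dz̄` is the Lebesgue measure of `ℂ`. -/
def characteristic (ρ : ℂ → ℝ) (r : ℝ) : ℝ :=
  ∫ t in (1 : ℝ)..r, (∫ z in Metric.ball (0 : ℂ) t, ρ z) / t

/-- The characteristic function of `σ_f = ‖ψ‖² (i/2) dz ∧ dz̄`. -/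
def charSigma (h : SesqForm V) (f : ℂ → ℙ ℂ V) (r : ℝ) : ℝ :=
  characteristic (psiNormSq h f) r

end PeriodCurve

end

open Set Filter Topology MeasureTheory
open scoped LinearAlgebra.Projectivization

namespace PeriodCurve

/-! ## Wirtinger calculus in one variable -/

/-! Let u = ω(f', f') (`speedSq`), a smooth nonnegative function on ℂ with countably many zeros. Off
the zeros, `curvature_identity` says ∂²(log u)/∂z∂z̄ = ‖ψ‖² + u: the first term is the contribution
of the second fundamental form of the tangent line bundle, the second comes from the curvature of ω.
Up to σ_f, the metric u|dz|² is thus negatively curved, and the theorem is an integrated form of the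
Ahlfors-Schwarz argument that ℂ carries no such metric.

Write T_u for the characteristic function of u. By Jensen's formula (`circleInt_sub_circleInt`), the
circle integral of log u grows at least like 4(T_σ + T_u); the zeros of u only help. Concavity of
the logarithm replaces the mean of log u by the logarithm of the mean of u. If T_σ is bounded below,
the circle integral m of u therefore satisfies m ≥ a exp(b T_u) with b = 2/π (`exp_le_circleInt`).
But (r d/dr)² T_u = r² m, so in the variable log r the function T_u satisfies T'' ≥ a exp(bT) on a
half-line while increasing, and such a function blows up in finite time (`false_of_exp_le`).

The geometric objects are computed in a lift F normalized by ℓ ∘ F = 1 for a linear functional ℓ: ω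
becomes `curvForm`, f' becomes the class of F', and ‖ψ‖² becomes `orthRatio` of F' and F''
(`psiNormSq_eq`). At a zero of f' one writes F' = (w - z)^m G. Positivity of ω on ℒ_z keeps ω(G, G)
away from 0, and `orthRatio` takes the same value on (F', F'') as on (G, G'). Hence the zeros of u
are isolated and ‖ψ‖² is locally integrable (`exists_local_model`). -/

/-- The real differential `v ↦ a v + b v̄`. -/
noncomputable def wirtingerMap (a b : ℂ) : ℂ →L[ℝ] ℂ :=
  a • ContinuousLinearMap.id ℝ ℂ + b • (Complex.conjCLE : ℂ →L[ℝ] ℂ)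

lemma wirtingerMap_apply (a b v : ℂ) :
    wirtingerMap a b v = a * v + b * (starRingEnd ℂ) v := by
  simp [wirtingerMap]

/-- `φ` is real differentiable at `z`, with `∂φ/∂z = a` and `∂φ/∂z̄ = b`. -/
def HasWirtinger (φ : ℂ → ℂ) (a b z : ℂ) : Prop :=
  HasFDerivAt φ (wirtingerMap a b) z

namespace HasWirtinger

variable {φ χ : ℂ → ℂ} {a b c d z : ℂ}

lemma of_hasFDerivAt {φ' : ℂ →L[ℝ] ℂ} (hφ : HasFDerivAt φ φ' z)
    (h : ∀ v, φ' v = a * v + b * (starRingEnd ℂ) v) : HasWirtinger φ a b z := by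
  have : φ' = wirtingerMap a b := by
    ext v
    all_goals simp [h, wirtingerMap_apply]
  rw [this] at hφ
  exact hφ

lemma del_eq (h : HasWirtinger φ a b z) : del φ z 1 = a := by
  have h' : fderiv ℝ φ z = wirtingerMap a b := HasFDerivAt.fderiv h
  simp only [del, h', wirtingerMap_apply, smul_eq_mul, mul_one, map_one, Complex.conj_I]
  linear_combination (-a / 2 + b / 2) * Complex.I_sq

lemma delBar_eq (h : HasWirtinger φ a b z) : delBar φ z 1 = b := by
  have h' : fderiv ℝ φ z = wirtingerMap a b := HasFDerivAt.fderiv h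
  simp only [delBar, h', wirtingerMap_apply, smul_eq_mul, mul_one, map_one, Complex.conj_I]
  linear_combination (a / 2 - b / 2) * Complex.I_sq

lemma of_differentiableAt (h : DifferentiableAt ℝ φ z) :
    HasWirtinger φ (del φ z 1) (delBar φ z 1) z := by
  refine of_hasFDerivAt h.hasFDerivAt fun v => ?_
  have hv : v = v.re • (1 : ℂ) + v.im • Complex.I := by
    simp [Complex.re_add_im]
  have e : (starRingEnd ℂ) v = v.re • (1 : ℂ) - v.im • Complex.I := by
    apply Complex.ext <;> simp
  rw [e]
  conv_lhs => rw [hv]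
  conv_rhs => rw [hv]
  rw [map_add, map_smul, map_smul]
  simp only [del, delBar, smul_eq_mul, mul_one, Complex.real_smul, Complex.add_re, Complex.mul_re,
    Complex.add_im, Complex.mul_im, Complex.ofReal_re, Complex.ofReal_im, Complex.I_re,
    Complex.I_im, mul_zero, sub_zero, mul_one, add_zero, zero_add]
  linear_combination ((v.im : ℂ) * fderiv ℝ φ z Complex.I) * Complex.I_sq

lemma congr_of_eventuallyEq (h : HasWirtinger φ a b z) (e : χ =ᶠ[𝓝 z] φ) :
    HasWirtinger χ a b z :=
  HasFDerivAt.congr_of_eventuallyEq h e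

lemma congr (h : HasWirtinger φ a b z) (ha : a = c) (hb : b = d) : HasWirtinger φ c d z := by
  subst ha hb; exact h

lemma const (c z : ℂ) : HasWirtinger (fun _ => c) 0 0 z :=
  of_hasFDerivAt (hasFDerivAt_const c z) (by simp)

lemma mul (h : HasWirtinger φ a b z) (k : HasWirtinger χ c d z) :
    HasWirtinger (fun w => φ w * χ w) (a * χ z + φ z * c) (b * χ z + φ z * d) z := by
  refine of_hasFDerivAt (HasFDerivAt.mul h k) fun v => ?_
  simp only [_root_.add_apply, _root_.smul_apply, smul_eq_mul,
    wirtingerMap_apply]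
  ring

lemma add (h : HasWirtinger φ a b z) (k : HasWirtinger χ c d z) :
    HasWirtinger (fun w => φ w + χ w) (a + c) (b + d) z := by
  refine of_hasFDerivAt (HasFDerivAt.add h k) fun v => ?_
  simp only [_root_.add_apply, wirtingerMap_apply]
  ring

lemma neg (h : HasWirtinger φ a b z) : HasWirtinger (fun w => -φ w) (-a) (-b) z := by
  refine of_hasFDerivAt (HasFDerivAt.neg h) fun v => ?_
  simp only [_root_.neg_apply, wirtingerMap_apply]
  ring

lemma sub (h : HasWirtinger φ a b z) (k : HasWirtinger χ c d z) :
    HasWirtinger (fun w => φ w - χ w) (a - c) (b - d) z := by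
  simpa [sub_eq_add_neg] using h.add k.neg

lemma const_mul (c : ℂ) (h : HasWirtinger φ a b z) :
    HasWirtinger (fun w => c * φ w) (c * a) (c * b) z :=
  ((const c z).mul h).congr (by ring) (by ring)

lemma inv (h : HasWirtinger φ a b z) (h0 : φ z ≠ 0) :
    HasWirtinger (fun w => (φ w)⁻¹) (-a / φ z ^ 2) (-b / φ z ^ 2) z := by
  have hi : HasFDerivAt (fun x : ℂ => x⁻¹) _ (φ z) :=
    ((hasDerivAt_inv h0).hasFDerivAt).restrictScalars ℝ
  refine of_hasFDerivAt (hi.comp z h) fun v => ?_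
  simp only [ContinuousLinearMap.comp_apply, ContinuousLinearMap.coe_restrictScalars',
    wirtingerMap_apply]
  simp
  ring

lemma div (h : HasWirtinger φ a b z) (k : HasWirtinger χ c d z) (h0 : χ z ≠ 0) :
    HasWirtinger (fun w => φ w / χ w) ((a * χ z - φ z * c) / χ z ^ 2)
      ((b * χ z - φ z * d) / χ z ^ 2) z := by
  simp only [div_eq_mul_inv (φ _)]
  refine (h.mul (k.inv h0)).congr ?_ ?_ <;> field_simp <;> ring

lemma differentiableAt (h : HasWirtinger φ a b z) : DifferentiableAt ℝ φ z :=
  HasFDerivAt.differentiableAt h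

end HasWirtinger

/-! ## Sesquilinear forms on finite-dimensional spaces -/

variable {V : Type*} [NormedAddCommGroup V] [NormedSpace ℂ V]

lemma IsHermitianForm.self_eq {k : SesqForm V} (hk : IsHermitianForm k) (x : V) :
    k x x = ((k x x).re : ℂ) :=
  (Complex.conj_eq_iff_re.1 (hk x x)).symm

lemma mk_eq_mk_of_smul {l : ℙ ℂ V} {v : V} (hv : v ∈ l.submodule) (hv0 : v ≠ 0) {a b : V}
    (h : (Submodule.Quotient.mk a : V ⧸ l.submodule) = Submodule.Quotient.mk b) :
    ∃ c : ℂ, a = b + c • v := by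
  have h1 := (Submodule.Quotient.eq _).1 h
  rw [l.submodule_eq] at h1 hv
  obtain ⟨c, hc⟩ := Submodule.mem_span_singleton.1 h1
  obtain ⟨d, hd⟩ := Submodule.mem_span_singleton.1 hv
  have hd0 : d ≠ 0 := by
    rintro rfl; exact hv0 (by rw [← hd, zero_smul])
  refine ⟨c / d, ?_⟩
  rw [← hd, smul_smul, div_mul_cancel₀ _ hd0, hc]
  abel

/-- A sesquilinear form as a real bilinear map. -/
noncomputable def SesqForm.realBilin (k : SesqForm V) : V →ₗ[ℝ] V →ₗ[ℝ] ℂ :=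
  LinearMap.mk₂ ℝ (fun x y => k x y) (by simp) (by
    intro c x y
    rw [← Complex.coe_smul (c : ℝ) x, map_smul]; simp) (by simp) (by
    intro c x y
    rw [← Complex.coe_smul (c : ℝ) y, LinearMap.map_smulₛₗ]; simp)

/-- A sesquilinear form on a finite-dimensional space as a continuous real bilinear map. -/
noncomputable def SesqForm.realCLM [FiniteDimensional ℂ V] (k : SesqForm V) :
    V →L[ℝ] V →L[ℝ] ℂ :=
  haveI : FiniteDimensional ℝ V := FiniteDimensional.complexToReal V
  k.realBilin.toContinuousBilinearMap

variable [FiniteDimensional ℂ V]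

@[simp] lemma SesqForm.realCLM_apply (k : SesqForm V) (x y : V) : k.realCLM x y = k x y := rfl

lemma SesqForm.hasFDerivAt {E : Type*} [NormedAddCommGroup E] [NormedSpace ℝ E] (k : SesqForm V)
    {X Y : E → V} {X' Y' : E →L[ℝ] V} {z : E} (hX : HasFDerivAt X X' z)
    (hY : HasFDerivAt Y Y' z) :
    HasFDerivAt (fun w => k (X w) (Y w))
      (k.realCLM.precompR E (X z) Y' + k.realCLM.precompL E X' (Y z)) z :=
  k.realCLM.hasFDerivAt_of_bilinear hX hY

/-- In the product rule the linear slot carries the whole (1,0)-part and the antilinear slot the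
whole (0,1)-part, because X and Y are holomorphic. -/
lemma SesqForm.hasWirtinger (k : SesqForm V) {X Y : ℂ → V} {X' Y' : V} {z : ℂ}
    (hX : HasDerivAt X X' z) (hY : HasDerivAt Y Y' z) :
    HasWirtinger (fun w => k (X w) (Y w)) (k X' (Y z)) (k (X z) Y') z := by
  refine HasWirtinger.of_hasFDerivAt (k.hasFDerivAt (hX.hasFDerivAt.restrictScalars ℝ)
    (hY.hasFDerivAt.restrictScalars ℝ)) fun v => ?_
  simp [ContinuousLinearMap.precompR_apply, ContinuousLinearMap.precompL_apply]
  ring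

lemma SesqForm.contDiffAt {E : Type*} [NormedAddCommGroup E] [NormedSpace ℝ E] (k : SesqForm V)
    {n : WithTop ℕ∞} {X Y : E → V} {z : E} (hX : ContDiffAt ℝ n X z) (hY : ContDiffAt ℝ n Y z) :
    ContDiffAt ℝ n (fun w => k (X w) (Y w)) z :=
  ContDiffAt.comp (g := fun q : V × V => k.realCLM q.1 q.2) z
    k.realCLM.isBoundedBilinearMap.contDiff.contDiffAt (hX.prodMk hY)

lemma SesqForm.continuousAt {E : Type*} [TopologicalSpace E] (k : SesqForm V)
    {X Y : E → V} {z : E} (hX : ContinuousAt X z) (hY : ContinuousAt Y z) :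
    ContinuousAt (fun w => k (X w) (Y w)) z :=
  ContinuousAt.comp (g := fun q : V × V => k.realCLM q.1 q.2)
    k.realCLM.isBoundedBilinearMap.continuous.continuousAt (hX.prodMk hY)

/-! ## The curvature of the tautological bundle -/

/-- The matrix of the curvature form of `𝒪(-1)` at the line of `v`, on the tangent vectors
represented by `a` and `b`. -/
noncomputable def curvForm (k : SesqForm V) (v a b : V) : ℂ :=
  -2 * ((k a b * k v v - k a v * k v b) / k v v ^ 2)

lemma delBar_log {k : SesqForm V} (hk : IsHermitianForm k) {y : V} (hy : 0 < (k y y).re) (b : V) :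
    delBar (fun v : V => ((Real.log (k v v).re : ℝ) : ℂ)) y b = k y b / k y y := by
  have h1 : HasFDerivAt (fun v : V => k v v) _ y :=
    k.hasFDerivAt (hasFDerivAt_id (𝕜 := ℝ) y) (hasFDerivAt_id (𝕜 := ℝ) y)
  have h2 := Complex.ofRealCLM.hasFDerivAt.comp y
    ((Complex.reCLM.hasFDerivAt.comp y h1).log hy.ne')
  have h3 : fderiv ℝ (fun v : V => ((Real.log (k v v).re : ℝ) : ℂ)) y = _ := h2.fderiv
  have e : k b y = (starRingEnd ℂ) (k y b) := (hk y b).symm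
  have hyy := hk.self_eq y
  have h0 : ((k y y).re : ℂ) ≠ 0 := by exact_mod_cast hy.ne'
  rw [delBar, h3]
  simp [ContinuousLinearMap.precompR_apply, ContinuousLinearMap.precompL_apply, e]
  rw [hyy]
  simp only [Complex.ofReal_re]
  field_simp
  apply Complex.ext <;> simp <;> ring_nf <;> simp

lemma complexHessian_log {k : SesqForm V} (hk : IsHermitianForm k) {x : V}
    (hx : 0 < (k x x).re) (a b : V) :
    -2 * complexHessian (fun v : V => ((Real.log (k v v).re : ℝ) : ℂ)) x a b =
      curvForm k x a b := by
  have h1 : ∀ y, HasFDerivAt (fun v : V => k v v) _ y := fun y =>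
    k.hasFDerivAt (hasFDerivAt_id (𝕜 := ℝ) y) (hasFDerivAt_id (𝕜 := ℝ) y)
  have hev : ∀ᶠ y in 𝓝 x, 0 < (k y y).re := by
    have : ContinuousAt (fun y => (k y y).re) x :=
      Complex.continuous_re.continuousAt.comp (h1 x).continuousAt
    exact this.eventually (lt_mem_nhds hx)
  -- The formula for the first derivative is needed on a neighbourhood, since it is differentiated
  -- again; positivity of k(y, y) is an open condition.
  have hcongr : (fun y => delBar (fun v : V => ((Real.log (k v v).re : ℝ) : ℂ)) y b) =ᶠ[𝓝 x]
      fun y => k y b / k y y := by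
    filter_upwards [hev] with y hy using delBar_log hk hy b
  have h0 : k x x ≠ 0 := by
    intro h; rw [h] at hx; simp at hx
  have h2 : HasFDerivAt (fun v : V => k v b) _ x :=
    k.hasFDerivAt (hasFDerivAt_id (𝕜 := ℝ) x) (hasFDerivAt_const (𝕜 := ℝ) b x)
  have hi : HasFDerivAt (fun x : ℂ => x⁻¹) _ (k x x) :=
    ((hasDerivAt_inv h0).hasFDerivAt).restrictScalars ℝ
  have h3 := h2.mul (HasFDerivAt.comp (f := fun v : V => k v v) x hi (h1 x))
  have h4 : fderiv ℝ (fun y => k y b / k y y) x = _ := h3.fderiv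
  rw [complexHessian, del, hcongr.fderiv_eq, h4, curvForm]
  simp [ContinuousLinearMap.precompR_apply, ContinuousLinearMap.precompL_apply]
  field_simp
  linear_combination (k a x * k x b - k a b * k x x - k x b * k x a) * Complex.I_sq

/-- Passing from v to c v multiplies the representatives a, b by c, up to multiples of v. The
multiples of v lie in the kernel of `curvForm`, and the factor |c|² cancels by homogeneity. This
frees the computations from `l.rep` and `Quotient.out`. -/
lemma tautCurvature_eq {k : SesqForm V} (hk : IsHermitianForm k) {l : ℙ ℂ V}
    (hl : l ∈ positiveDomain k) {v : V} (hv : v ∈ l.submodule) (hv0 : v ≠ 0) {u u' : Tan l}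
    {a b : V} (ha : u ⟨v, hv⟩ = Submodule.Quotient.mk a)
    (hb : u' ⟨v, hv⟩ = Submodule.Quotient.mk b) :
    tautCurvature k l u u' = curvForm k v a b := by
  have hx0 : l.rep ≠ 0 := l.rep_nonzero
  have hx := hl _ (rep_mem l) hx0
  rw [tautCurvature, complexHessian_log hk hx]
  obtain ⟨c, hc⟩ : ∃ c : ℂ, c • v = l.rep := by
    have := rep_mem l
    have h2 := hv
    rw [l.submodule_eq] at h2
    obtain ⟨d, hd⟩ := Submodule.mem_span_singleton.1 h2
    have hd0 : d ≠ 0 := by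
      rintro rfl; exact hv0 (by rw [← hd, zero_smul])
    exact ⟨d⁻¹, by rw [← hd, smul_smul, inv_mul_cancel₀ hd0, one_smul]⟩
  have hc0 : c ≠ 0 := by
    rintro rfl; exact hx0 (by rw [← hc, zero_smul])
  have key : ∀ (w : Tan l) (e : V), w ⟨v, hv⟩ = Submodule.Quotient.mk e →
      ∃ d : ℂ, Quotient.out (w ⟨l.rep, rep_mem l⟩) = c • e + d • v := by
    intro w e he
    apply mk_eq_mk_of_smul hv hv0
    have h1 : (⟨l.rep, rep_mem l⟩ : l.submodule) = c • ⟨v, hv⟩ := Subtype.ext hc.symm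
    rw [Submodule.Quotient.mk_smul, ← he, ← map_smul, ← h1]
    exact Quotient.out_eq _
  obtain ⟨d, hd⟩ := key u a ha
  obtain ⟨d', hd'⟩ := key u' b hb
  have hvv : k v v ≠ 0 := by
    intro h
    have := hl v hv hv0
    rw [h] at this; simp at this
  have hcc : (starRingEnd ℂ) c ≠ 0 := by simpa using hc0
  rw [hd, hd', ← hc, curvForm, curvForm]
  simp
  field_simp
  ring

end PeriodCurve

namespace PeriodCurve

/-! ## Green's formula on discs -/

lemma HasWirtinger.comp_hasDerivAt {φ : ℂ → ℂ} {γ : ℝ → ℂ} {a b γ' : ℂ} {t : ℝ}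
    (h : HasWirtinger φ a b (γ t)) (hγ : HasDerivAt γ γ' t) :
    HasDerivAt (fun s => φ (γ s)) (a * γ' + b * (starRingEnd ℂ) γ') t := by
  have := HasFDerivAt.comp_hasDerivAt t h hγ
  rwa [wirtingerMap_apply] at this

lemma intervalIntegral_swap_of_continuous {F : ℝ → ℝ → ℂ} (hF : Continuous (Function.uncurry F))
    (a b c d : ℝ) :
    ∫ x in a..b, ∫ y in c..d, F x y = ∫ y in c..d, ∫ x in a..b, F x y := by
  apply intervalIntegral_intervalIntegral_swap
  apply (hF.continuousOn.integrableOn_compact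
    ((isCompact_uIcc (a := a) (b := b)).prod (isCompact_uIcc (a := c) (b := d)))).mono_set
  exact prod_mono uIoc_subset_uIcc uIoc_subset_uIcc

/-- The integral of `q` over the circle of radius `r`, with respect to the angle. -/
noncomputable def circleInt {E : Type*} [NormedAddCommGroup E] [NormedSpace ℝ E]
    (q : ℂ → E) (r : ℝ) : E :=
  ∫ θ in (-Real.pi)..Real.pi, q (r * Complex.exp (θ * Complex.I))

lemma continuous_circleInt {q : ℂ → ℝ} (hq : Continuous q) : Continuous (circleInt q) := by
  unfold circleInt
  apply intervalIntegral.continuous_parametric_intervalIntegral_of_continuous'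
  fun_prop

lemma norm_mul_exp_I {r : ℝ} (hr : 0 ≤ r) (θ : ℝ) :
    ‖(r : ℂ) * Complex.exp (θ * Complex.I)‖ = r := by
  rw [norm_mul, Complex.norm_exp_ofReal_mul_I, mul_one, Complex.norm_real, Real.norm_of_nonneg hr]

/-- Polar coordinates followed by Fubini; the angle range of `circleInt` is that of `polarCoord`. -/
lemma setIntegral_ball_eq {E : Type*} [NormedAddCommGroup E] [NormedSpace ℝ E] {q : ℂ → E}
    (hq : Continuous q) {R : ℝ} (hR : 0 ≤ R) :
    ∫ z in Metric.ball (0 : ℂ) R, q z = ∫ r in (0 : ℝ)..R, r • circleInt q r := by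
  have hG : Continuous fun p : ℝ × ℝ => p.1 • q (p.1 * Complex.exp (p.2 * Complex.I)) := by
    fun_prop
  rw [← integral_indicator Metric.isOpen_ball.measurableSet,
    ← Complex.integral_comp_polarCoord_symm]
  have h1 : ∀ p ∈ polarCoord.target,
      p.1 • (Metric.ball (0 : ℂ) R).indicator q (Complex.polarCoord.symm p) =
      (Iio R ×ˢ univ : Set (ℝ × ℝ)).indicator
        (fun p : ℝ × ℝ => p.1 • q (p.1 * Complex.exp (p.2 * Complex.I))) p := by
    rintro ⟨r, θ⟩ hp
    have hr : 0 < r := hp.1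
    have hs : Complex.polarCoord.symm (r, θ) = r * Complex.exp (θ * Complex.I) := by
      rw [Complex.polarCoord_symm_apply, Complex.exp_mul_I, Complex.ofReal_cos, Complex.ofReal_sin]
    rw [hs]
    by_cases h : r < R
    · rw [indicator_of_mem (by simpa [abs_of_pos hr] using h), indicator_of_mem (by simpa)]
    · rw [indicator_of_notMem (by simpa [abs_of_pos hr] using h),
        indicator_of_notMem (by simpa using h), smul_zero]
  rw [setIntegral_congr_fun polarCoord.open_target.measurableSet h1,
    setIntegral_indicator (measurableSet_Iio.prod MeasurableSet.univ)]
  have h2 : polarCoord.target ∩ (Iio R ×ˢ univ) = Ioo 0 R ×ˢ Ioo (-Real.pi) Real.pi := by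
    ext ⟨r, θ⟩
    simp [polarCoord]
    tauto
  rw [h2, Measure.volume_eq_prod, setIntegral_prod]
  · rw [intervalIntegral.integral_of_le hR, integral_Ioc_eq_integral_Ioo]
    refine setIntegral_congr_fun measurableSet_Ioo fun r _ => ?_
    simp only [circleInt]
    rw [intervalIntegral.integral_of_le (by linarith [Real.pi_pos]), integral_Ioc_eq_integral_Ioo,
      integral_smul]
  · rw [← Measure.volume_eq_prod]
    exact (hG.continuousOn.integrableOn_compact (isCompact_Icc.prod isCompact_Icc)).mono_set
      (prod_mono Ioo_subset_Icc_self Ioo_subset_Icc_self)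

lemma hasDerivAt_exp_mul_I (θ : ℝ) :
    HasDerivAt (fun θ : ℝ => Complex.exp (θ * Complex.I))
      (Complex.I * Complex.exp (θ * Complex.I)) θ := by
  have := ((Complex.ofRealCLM.hasDerivAt (x := θ)).mul_const Complex.I).cexp
  simpa [mul_comm] using this

lemma conj_exp_mul_exp (θ : ℝ) :
    (starRingEnd ℂ) (Complex.exp (θ * Complex.I)) * Complex.exp (θ * Complex.I) = 1 := by
  rw [← Complex.exp_conj, ← Complex.exp_add]
  simp

lemma contDiff_del {φ : ℂ → ℂ} {n m : WithTop ℕ∞} (hφ : ContDiff ℝ n φ) (hmn : m + 1 ≤ n) :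
    ContDiff ℝ m fun z => del φ z 1 := by
  have h : ContDiff ℝ m (fderiv ℝ φ) := hφ.fderiv_right hmn
  unfold del
  fun_prop

lemma contDiff_delBar {φ : ℂ → ℂ} {n m : WithTop ℕ∞} (hφ : ContDiff ℝ n φ) (hmn : m + 1 ≤ n) :
    ContDiff ℝ m fun z => delBar φ z 1 := by
  have h : ContDiff ℝ m (fderiv ℝ φ) := hφ.fderiv_right hmn
  unfold delBar
  fun_prop

/-- Stokes' formula for P dz. With e = exp(iθ), the r-derivative of P(re)·re is 2r ∂̄P + K, and iK
is the θ-derivative of the periodic function P(re)·e. So K integrates to 0 over each circle, and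
integrating in r leaves twice the area integral of ∂̄P. -/
lemma circleInt_mul_eq_setIntegral_delBar {P : ℂ → ℂ} (hP : ContDiff ℝ 1 P) {R : ℝ} (hR : 0 ≤ R) :
    circleInt (fun z => P z * z) R =
      2 * ∫ z in Metric.ball (0 : ℂ) R, delBar P z 1 := by
  have hPc : Continuous P := hP.continuous
  have hP1 : Continuous fun z => del P z 1 := (contDiff_del hP (m := 0) (by simp)).continuous
  have hP2 : Continuous fun z => delBar P z 1 := (contDiff_delBar hP (m := 0) (by simp)).continuous
  have hW : ∀ z, HasWirtinger P (del P z 1) (delBar P z 1) z := fun z =>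
    HasWirtinger.of_differentiableAt (hP.differentiable (by simp)).differentiableAt
  set e : ℝ → ℂ := fun θ => Complex.exp (θ * Complex.I) with he
  have hec : Continuous e := by fun_prop
  let K : ℝ → ℝ → ℂ := fun r θ => del P (r * e θ) 1 * r * e θ ^ 2 - delBar P (r * e θ) 1 * r +
    P (r * e θ) * e θ
  let G : ℝ → ℝ → ℂ := fun r θ => 2 * r * delBar P (r * e θ) 1 + K r θ
  have hKc : Continuous (Function.uncurry K) := by
    simp only [K, Function.uncurry_def]; fun_prop
  have hGc : Continuous (Function.uncurry G) := by
    simp only [G, K, Function.uncurry_def]; fun_prop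
  have hr : ∀ θ r : ℝ, HasDerivAt (fun r : ℝ => P (r * e θ) * (r * e θ)) (G r θ) r := by
    intro θ r
    have h1 : HasDerivAt (fun r : ℝ => (r : ℂ) * e θ) (e θ) r := by
      simpa using (Complex.ofRealCLM.hasDerivAt (x := r)).mul_const (e θ)
    have h2 := ((hW (r * e θ)).comp_hasDerivAt (γ := fun r : ℝ => (r : ℂ) * e θ) h1).mul h1
    refine h2.congr_deriv ?_
    simp only [G, K]
    linear_combination (r * delBar P (r * e θ) 1) * conj_exp_mul_exp θ
  have hθ : ∀ r θ : ℝ, HasDerivAt (fun θ : ℝ => P (r * e θ) * e θ) (Complex.I * K r θ) θ := by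
    intro r θ
    have h1 : HasDerivAt (fun θ : ℝ => (r : ℂ) * e θ) (r * (Complex.I * e θ)) θ :=
      (hasDerivAt_exp_mul_I θ).const_mul _
    have h2 := ((hW (r * e θ)).comp_hasDerivAt (γ := fun θ : ℝ => (r : ℂ) * e θ) h1).mul (hasDerivAt_exp_mul_I θ)
    refine h2.congr_deriv ?_
    simp only [K, map_mul, Complex.conj_I, Complex.conj_ofReal]
    linear_combination (-Complex.I * r * delBar P (r * e θ) 1) * conj_exp_mul_exp θ
  have hK0 : ∀ r : ℝ, ∫ θ in (-Real.pi)..Real.pi, K r θ = 0 := by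
    intro r
    have h1 := intervalIntegral.integral_eq_sub_of_hasDerivAt (a := -Real.pi) (b := Real.pi)
      (fun θ _ => hθ r θ)
      (Continuous.intervalIntegrable (continuous_const.mul (hKc.comp (by fun_prop :
        Continuous fun θ : ℝ => (r, θ)))) _ _)
    have h2 : e Real.pi = e (-Real.pi) := by
      simp [he, Complex.exp_pi_mul_I, Complex.exp_neg]
    rw [intervalIntegral.integral_const_mul, h2, sub_self] at h1
    simpa using h1
  have hleft : circleInt (fun z => P z * z) R =
      ∫ θ in (-Real.pi)..Real.pi, ∫ r in (0 : ℝ)..R, G r θ := by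
    unfold circleInt
    refine intervalIntegral.integral_congr fun θ _ => ?_
    simp only
    rw [intervalIntegral.integral_eq_sub_of_hasDerivAt (fun r _ => hr θ r)
      (Continuous.intervalIntegrable (hGc.comp (by fun_prop :
        Continuous fun r : ℝ => (r, θ))) _ _)]
    simp [he]
  rw [hleft, ← intervalIntegral_swap_of_continuous hGc, setIntegral_ball_eq hP2 hR,
    ← intervalIntegral.integral_const_mul]
  refine intervalIntegral.integral_congr fun r _ => ?_
  simp only [G]
  rw [intervalIntegral.integral_add, hK0, add_zero, intervalIntegral.integral_const_mul]
  · simp [circleInt, he, mul_assoc]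
  · exact Continuous.intervalIntegrable (by fun_prop) _ _
  · exact Continuous.intervalIntegrable (hKc.comp (by fun_prop :
        Continuous fun θ : ℝ => (r, θ))) _ _

/-- The function `∂²φ/∂z∂z̄`, a quarter of the Laplacian, of a real function `φ`. -/
noncomputable def ddbar (φ : ℂ → ℝ) (z : ℂ) : ℝ :=
  (delBar (fun w => del (fun x => (φ x : ℂ)) w 1) z 1).re

lemma delBar_ofReal {φ : ℂ → ℝ} {z : ℂ} (hφ : DifferentiableAt ℝ φ z) :
    delBar (fun x => (φ x : ℂ)) z 1 = (starRingEnd ℂ) (del (fun x => (φ x : ℂ)) z 1) := by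
  have h : fderiv ℝ (fun x => (φ x : ℂ)) z = _ :=
    (Complex.ofRealCLM.hasFDerivAt.comp z hφ.hasFDerivAt).fderiv
  simp [del, delBar, h, Complex.conj_ofNat]

lemma contDiff_ofReal_comp {φ : ℂ → ℝ} {n : WithTop ℕ∞} (hφ : ContDiff ℝ n φ) :
    ContDiff ℝ n fun x => (φ x : ℂ) :=
  Complex.ofRealCLM.contDiff.comp hφ

lemma continuous_ddbar {φ : ℂ → ℝ} (hφ : ContDiff ℝ 2 φ) : Continuous (ddbar φ) :=
  Complex.continuous_re.comp (contDiff_delBar (m := 0)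
    (contDiff_del (m := 1) (contDiff_ofReal_comp hφ) (by norm_num)) (by simp)).continuous

/-- Jensen's formula. The r-derivative of the circle integral of φ is 2 Re ∫ ∂φ·exp(iθ) dθ, and
Stokes' formula for P = ∂φ turns it into 4/r times the integral of `ddbar φ` over the disc. -/
theorem circleInt_sub_circleInt {φ : ℂ → ℝ} (hφ : ContDiff ℝ 2 φ) {r₀ R : ℝ} (h0 : 0 < r₀)
    (hR : r₀ ≤ R) :
    circleInt φ R - circleInt φ r₀ =
      4 * ∫ t in r₀..R, (∫ z in Metric.ball (0 : ℂ) t, ddbar φ z) / t := by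
  set P : ℂ → ℂ := fun z => del (fun x => (φ x : ℂ)) z 1 with hPdef
  have hP : ContDiff ℝ 1 P := contDiff_del (contDiff_ofReal_comp hφ) (by norm_num)
  have hPc := hP.continuous
  have hφc := hφ.continuous
  set e : ℝ → ℂ := fun θ => Complex.exp (θ * Complex.I) with he
  have hec : Continuous e := by fun_prop
  have hd : Differentiable ℝ φ := hφ.differentiable (by simp)
  have hW : ∀ z, HasWirtinger (fun x => (φ x : ℂ)) (P z) ((starRingEnd ℂ) (P z)) z := fun z =>
    (HasWirtinger.of_differentiableAt
      ((contDiff_ofReal_comp hφ).differentiable (by simp)).differentiableAt).congr rfl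
      (delBar_ofReal (hd z))
  let G : ℝ → ℝ → ℂ := fun r θ => ((2 * (P (r * e θ) * e θ).re : ℝ) : ℂ)
  have hGc : Continuous (Function.uncurry G) := by
    simp only [G, Function.uncurry_def]; fun_prop
  have hr : ∀ θ r : ℝ, HasDerivAt (fun r : ℝ => (φ (r * e θ) : ℂ)) (G r θ) r := by
    intro θ r
    have h1 : HasDerivAt (fun r : ℝ => (r : ℂ) * e θ) (e θ) r := by
      simpa using (Complex.ofRealCLM.hasDerivAt (x := r)).mul_const (e θ)
    have h2 := (hW (r * e θ)).comp_hasDerivAt (γ := fun r : ℝ => (r : ℂ) * e θ) h1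
    convert h2 using 1
    simp only [G]
    rw [← map_mul, Complex.add_conj]
  have key : ((circleInt φ R - circleInt φ r₀ : ℝ) : ℂ) =
      ∫ θ in (-Real.pi)..Real.pi, ∫ r in r₀..R, G r θ := by
    have : ∀ θ : ℝ, ∫ r in r₀..R, G r θ = ((φ (R * e θ) - φ (r₀ * e θ) : ℝ) : ℂ) := by
      intro θ
      rw [intervalIntegral.integral_eq_sub_of_hasDerivAt (fun r _ => hr θ r)
        (Continuous.intervalIntegrable (hGc.comp (by fun_prop :
        Continuous fun r : ℝ => (r, θ))) _ _)]
      simp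
    simp only [this]
    rw [intervalIntegral.integral_ofReal, intervalIntegral.integral_sub]
    · rfl
    · exact Continuous.intervalIntegrable (by fun_prop) _ _
    · exact Continuous.intervalIntegrable (by fun_prop) _ _
  rw [← intervalIntegral_swap_of_continuous hGc] at key
  simp only [G, intervalIntegral.integral_ofReal] at key
  rw [Complex.ofReal_inj.1 key, ← intervalIntegral.integral_const_mul]
  refine intervalIntegral.integral_congr fun r hr => ?_
  have hr0 : 0 < r := by
    rw [uIcc_of_le hR] at hr
    exact h0.trans_le hr.1
  have h1 := circleInt_mul_eq_setIntegral_delBar hP hr0.le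
  have h2 : circleInt (fun z => P z * z) r =
      r * ∫ θ in (-Real.pi)..Real.pi, P (r * e θ) * e θ := by
    rw [← intervalIntegral.integral_const_mul]
    refine intervalIntegral.integral_congr fun θ _ => ?_
    simp only [he]
    ring
  have hint : IntegrableOn (fun z => delBar P z 1) (Metric.ball (0 : ℂ) r) :=
    ((contDiff_delBar hP (m := 0) (by simp)).continuous.continuousOn.integrableOn_compact
      (isCompact_closedBall _ _)).mono_set Metric.ball_subset_closedBall
  have h3 : (∫ z in Metric.ball (0 : ℂ) r, ddbar φ z) =
      (∫ z in Metric.ball (0 : ℂ) r, delBar P z 1).re :=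
    Complex.reCLM.integral_comp_comm hint
  have h4 : (∫ θ in (-Real.pi)..Real.pi, (P (r * e θ) * e θ).re) =
      (∫ θ in (-Real.pi)..Real.pi, P (r * e θ) * e θ).re :=
    Complex.reCLM.intervalIntegral_comp_comm (f := fun θ : ℝ => P (r * e θ) * e θ)
      (Continuous.intervalIntegrable (by fun_prop) _ _)
  rw [h2] at h1
  have h5 := congrArg Complex.re h1
  rw [Complex.re_ofReal_mul, Complex.mul_re, Complex.re_ofNat, Complex.im_ofNat, zero_mul,
    sub_zero] at h5
  rw [intervalIntegral.integral_const_mul, h4, h3]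
  rw [← mul_div_assoc, eq_div_iff hr0.ne']
  linarith

end PeriodCurve

namespace PeriodCurve

/-! ## A blow-up lemma -/

/-- The inequality `T'' ≥ a exp (b T)` in the variable `log r` has no solution with `T' > 0` on a
half-line. -/
lemma false_of_exp_le {m U T : ℝ → ℝ} {a b r₀ : ℝ} (ha : 0 < a) (hb : 0 < b) (hr₀ : 1 ≤ r₀)
    (hU : ∀ r, r₀ ≤ r → HasDerivAt U (r * m r) r) (hT : ∀ r, r₀ ≤ r → HasDerivAt T (U r / r) r)
    (hU0 : 0 < U r₀) (hm : ∀ r, r₀ ≤ r → a * Real.exp (b * T r) ≤ m r) : False := by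
  have mono : ∀ (f f' : ℝ → ℝ), (∀ r, r₀ ≤ r → HasDerivAt f (f' r) r) →
      (∀ r, r₀ ≤ r → 0 ≤ f' r) → ∀ r, r₀ ≤ r → f r₀ ≤ f r := by
    intro f f' hf hf' r hr
    refine (monotoneOn_of_deriv_nonneg (convex_Ici r₀)
      (fun x hx => (hf x hx).continuousAt.continuousWithinAt) ?_ ?_) self_mem_Ici hr hr
    · intro x hx
      rw [interior_Ici] at hx
      exact (hf x (le_of_lt hx)).differentiableAt.differentiableWithinAt
    · intro x hx
      rw [interior_Ici] at hx
      rw [(hf x (le_of_lt hx)).deriv]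
      exact hf' x (le_of_lt hx)
  have hpos : ∀ r, r₀ ≤ r → 0 < r := fun r hr => by linarith
  have hmpos : ∀ r, r₀ ≤ r → 0 < m r := fun r hr => lt_of_lt_of_le (by positivity) (hm r hr)
  have hUpos : ∀ r, r₀ ≤ r → 0 < U r := fun r hr =>
    hU0.trans_le (mono U _ hU (fun x hx => (mul_pos (hpos x hx) (hmpos x hx)).le) r hr)
  have hTmono : ∀ r, r₀ ≤ r → T r₀ ≤ T r := mono T _ hT
    fun x hx => (div_pos (hUpos x hx) (hpos x hx)).le
  -- The energy obtained by multiplying T'' ≥ a exp(bT) by T' in the variable log r, where U = r T'.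
  -- It is nondecreasing because r ≥ 1 gives r m ≥ m ≥ a exp(bT) ≥ a exp(bT)/r.
  have hE := mono (fun r => U r ^ 2 / 2 - a / b * Real.exp (b * T r))
    (fun r => U r * (r * m r - a * Real.exp (b * T r) / r))
    (by
      intro r hr
      have h1 := (((hU r hr).pow 2).div_const 2).sub
        ((((hT r hr).const_mul b).exp).const_mul (a / b))
      refine h1.congr_deriv ?_
      have := hpos r hr
      field_simp
      simp
      ring)
    (by
      intro r hr
      refine mul_nonneg (hUpos r hr).le (sub_nonneg.2 ?_)
      have h1 : 1 ≤ r := hr₀.trans hr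
      have h2 : a * Real.exp (b * T r) / r ≤ a * Real.exp (b * T r) :=
        div_le_self (by positivity) h1
      have h3 : m r ≤ r * m r := le_mul_of_one_le_left (hmpos r hr).le h1
      linarith [hm r hr])
  set K := Real.exp (b * T r₀) with hK
  have hKpos : 0 < K := Real.exp_pos _
  -- The first bound lets c²/2 replace a/b in the energy inequality, the second covers the initial
  -- value at r₀; together they give U ≥ c exp(bT/2).
  obtain ⟨c, hc, hc1, hc2⟩ : ∃ c : ℝ, 0 < c ∧ c ^ 2 / 2 ≤ a / b ∧ c ^ 2 / 2 * K ≤ U r₀ ^ 2 / 2 := by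
    refine ⟨Real.sqrt (2 * min (a / b) (U r₀ ^ 2 / 2 / K)), by positivity, ?_, ?_⟩
    · rw [Real.sq_sqrt (by positivity)]
      linarith [min_le_left (a / b) (U r₀ ^ 2 / 2 / K)]
    · rw [Real.sq_sqrt (by positivity), ← le_div_iff₀ hKpos]
      linarith [min_le_right (a / b) (U r₀ ^ 2 / 2 / K)]
  have hUsq : ∀ r, r₀ ≤ r → c * Real.exp (b * T r / 2) ≤ U r := by
    intro r hr
    have h1 := hE r hr
    have h2 : K ≤ Real.exp (b * T r) := by
      rw [hK, Real.exp_le_exp]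
      exact mul_le_mul_of_nonneg_left (hTmono r hr) hb.le
    have h3 : Real.exp (b * T r) = Real.exp (b * T r / 2) ^ 2 := by
      rw [← Real.exp_nat_mul]; congr 1; push_cast; ring
    have h4 : 0 ≤ (a / b - c ^ 2 / 2) * (Real.exp (b * T r) - K) :=
      mul_nonneg (by linarith) (by linarith)
    refine le_of_sq_le_sq ?_ (hUpos r hr).le
    rw [mul_pow, ← h3]
    nlinarith
  -- Integrating r T' = U ≥ c exp(bT/2): the function -exp(-bT/2) would have to grow at least like
  -- (bc/2) log r, yet it stays negative.
  have hW := mono (fun r => -Real.exp (-(b / 2) * T r) - b * c / 2 * Real.log r)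
    (fun r => b / 2 * (U r * Real.exp (-(b / 2) * T r) - c) / r)
    (by
      intro r hr
      have h1 := (((hT r hr).const_mul (-(b / 2))).exp.neg).sub
        ((Real.hasDerivAt_log (hpos r hr).ne').const_mul (b * c / 2))
      refine h1.congr_deriv ?_
      have := hpos r hr
      field_simp)
    (by
      intro r hr
      refine div_nonneg (mul_nonneg (by positivity) (sub_nonneg.2 ?_)) (hpos r hr).le
      calc c = c * Real.exp (b * T r / 2) * Real.exp (-(b / 2) * T r) := by
            rw [mul_assoc, ← Real.exp_add]; ring_nf; simp
        _ ≤ _ := mul_le_mul_of_nonneg_right (hUsq r hr) (Real.exp_pos _).le)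
  have hlog : Tendsto (fun r => b * c / 2 * Real.log r) atTop atTop :=
    Real.tendsto_log_atTop.const_mul_atTop (by positivity)
  obtain ⟨r, h1, h2⟩ := ((hlog.eventually_gt_atTop
    (Real.exp (-(b / 2) * T r₀) + b * c / 2 * Real.log r₀)).and (eventually_ge_atTop r₀)).exists
  have h3 := hW r h2
  linarith [Real.exp_pos (-(b / 2) * T r)]

end PeriodCurve

namespace PeriodCurve

/-! ## Metrics of negative curvature in the mean -/

/-- Circles are null sets, so for almost every z the indicator of the ball is locally constant in
the radius near t; dominated convergence concludes. -/
lemma continuous_setIntegral_ball {g : ℂ → ℝ} (hg : LocallyIntegrable g) :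
    Continuous fun t : ℝ => ∫ z in Metric.ball (0 : ℂ) t, g z := by
  rw [continuous_iff_continuousAt]
  intro t
  simp only [← integral_indicator Metric.isOpen_ball.measurableSet]
  have hI : IntegrableOn g (Metric.closedBall (0 : ℂ) (t + 1)) :=
    hg.integrableOn_isCompact (isCompact_closedBall _ _)
  refine continuousAt_of_dominated
    (bound := (Metric.closedBall (0 : ℂ) (t + 1)).indicator fun z => ‖g z‖) ?_ ?_ ?_ ?_
  · exact Eventually.of_forall fun s =>
      hg.aestronglyMeasurable.indicator Metric.isOpen_ball.measurableSet
  · filter_upwards [Iio_mem_nhds (lt_add_one t)] with s hs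
    refine Eventually.of_forall fun z => ?_
    rw [norm_indicator_eq_indicator_norm]
    exact indicator_le_indicator_of_subset
      (Metric.ball_subset_closedBall.trans (Metric.closedBall_subset_closedBall (le_of_lt hs)))
      (fun _ => norm_nonneg _) z
  · exact (integrable_indicator_iff Metric.isClosed_closedBall.measurableSet).2 hI.norm
  · have hnull : ∀ᵐ z : ℂ, z ∉ Metric.sphere (0 : ℂ) t := by
      rw [← measure_eq_zero_iff_ae_notMem]
      exact Measure.addHaar_sphere volume 0 t
    filter_upwards [hnull] with z hz
    have hz' : ‖z‖ ≠ t := by simpa using hz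
    rcases lt_or_gt_of_ne hz' with h | h
    · refine (continuousAt_const (y := g z)).congr ?_
      filter_upwards [Ioi_mem_nhds h] with s hs
      rw [indicator_of_mem (by simpa using hs)]
    · refine (continuousAt_const (y := (0 : ℝ))).congr ?_
      filter_upwards [Iio_mem_nhds h] with s hs
      rw [indicator_of_notMem (by simpa using le_of_lt hs)]

lemma intervalIntegrable_setIntegral_ball_div {g : ℂ → ℝ} (hg : LocallyIntegrable g) {a b : ℝ}
    (ha : 0 < a) (hb : 0 < b) :
    IntervalIntegrable (fun t => (∫ z in Metric.ball (0 : ℂ) t, g z) / t) volume a b := by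
  refine ContinuousOn.intervalIntegrable
    ((continuous_setIntegral_ball hg).continuousOn.div continuousOn_id fun t ht => ?_)
  exact ((lt_min ha hb).trans_le ht.1).ne'

/-- The quotient rule for ∂u/(u + δ), with ∂̄u the conjugate of ∂u. The shift δ keeps the logarithm
smooth across the zeros of u, so that Jensen's formula for smooth functions applies. -/
lemma ddbar_log_add {u : ℂ → ℝ} (hu : ContDiff ℝ 2 u) {δ : ℝ} (hδ : ∀ z, 0 < u z + δ) (z : ℂ) :
    ddbar (fun w => Real.log (u w + δ)) z =
      (ddbar u z * (u z + δ) - Complex.normSq (del (fun w => (u w : ℂ)) z 1)) / (u z + δ) ^ 2 := by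
  set U : ℂ → ℂ := fun w => (u w : ℂ) with hU
  have hUd : ∀ w, HasWirtinger U (del U w 1) (delBar U w 1) w := fun w =>
    HasWirtinger.of_differentiableAt
      ((contDiff_ofReal_comp hu).differentiable (by simp)).differentiableAt
  have hconj : ∀ w, delBar U w 1 = (starRingEnd ℂ) (del U w 1) := fun w =>
    delBar_ofReal (hu.differentiable (by simp)).differentiableAt
  have h1 : ∀ w, del (fun x => ((Real.log (u x + δ) : ℝ) : ℂ)) w 1 = del U w 1 / (U w + δ) := by
    intro w
    have hd : DifferentiableAt ℝ u w := (hu.differentiable (by simp)).differentiableAt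
    have h2 := Complex.ofRealCLM.hasFDerivAt.comp w ((hd.hasFDerivAt.add_const δ).log (hδ w).ne')
    have h3 : fderiv ℝ (fun x => ((Real.log (u x + δ) : ℝ) : ℂ)) w = _ := h2.fderiv
    have h4 : fderiv ℝ U w = _ := (Complex.ofRealCLM.hasFDerivAt.comp w hd.hasFDerivAt).fderiv
    have h5 : (U w + δ : ℂ) ≠ 0 := by
      have := (hδ w).ne'
      simp only [hU]
      exact_mod_cast this
    simp only [del, h3, h4]
    simp [hU]
    simp only [hU] at h5
    field_simp
  have h2 : HasWirtinger (fun w => del U w 1) (del (fun w => del U w 1) z 1)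
      (delBar (fun w => del U w 1) z 1) z :=
    HasWirtinger.of_differentiableAt
      ((contDiff_del (m := 1) (contDiff_ofReal_comp hu) (by norm_num)).differentiable
        (by simp)).differentiableAt
  have h5 : (U z + δ : ℂ) ≠ 0 := by
    have := (hδ z).ne'
    simp only [hU]
    exact_mod_cast this
  have h3 := (h2.div ((hUd z).add (HasWirtinger.const δ z)) h5).delBar_eq
  simp only [ddbar, h1]
  rw [h3, hconj, add_zero, Complex.mul_conj]
  have e : (U z + δ) ^ 2 = (((u z + δ) ^ 2 : ℝ) : ℂ) := by simp [hU]
  have e' : U z + δ = ((u z + δ : ℝ) : ℂ) := by simp [hU]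
  rw [e, e', Complex.div_ofReal_re, Complex.sub_re, Complex.re_mul_ofReal, Complex.ofReal_re]

lemma circleInt_const (c r : ℝ) : circleInt (fun _ => c) r = 2 * Real.pi * c := by
  rw [circleInt, intervalIntegral.integral_const, smul_eq_mul]
  ring

lemma circleInt_mono {p q : ℂ → ℝ} (hp : Continuous p) (hq : Continuous q) {r : ℝ} (hr : 0 ≤ r)
    (h : ∀ z, ‖z‖ = r → p z ≤ q z) : circleInt p r ≤ circleInt q r := by
  unfold circleInt
  refine intervalIntegral.integral_mono (by linarith [Real.pi_pos])
    (Continuous.intervalIntegrable (by fun_prop) _ _)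
    (Continuous.intervalIntegrable (by fun_prop) _ _) fun θ => ?_
  exact h _ (norm_mul_exp_I hr θ)

/-- Jensen's inequality for the logarithm on a circle. -/
lemma circleInt_log_le {u : ℂ → ℝ} (hu : Continuous u) (hpos : ∀ z, 0 < u z) {r : ℝ}
    (hr : 0 ≤ r) :
    circleInt (fun z => Real.log (u z)) r ≤
      2 * Real.pi * Real.log (circleInt u r / (2 * Real.pi)) := by
  have hl : Continuous fun z => Real.log (u z) := hu.log fun z => (hpos z).ne'
  have hI : 0 < circleInt u r := by
    unfold circleInt
    exact intervalIntegral.intervalIntegral_pos_of_pos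
      (Continuous.intervalIntegrable (by fun_prop) _ _) (fun θ => hpos _)
      (by linarith [Real.pi_pos])
  set A := circleInt u r / (2 * Real.pi) with hA
  have hApos : 0 < A := by positivity
  have h1 : circleInt (fun z => Real.log (u z)) r ≤
      circleInt (fun z => A⁻¹ * u z + (Real.log A - 1)) r := by
    -- The tangent line of the logarithm at the mean A lies above its graph: log u ≤ u/A + log A -
    -- 1.
    refine circleInt_mono hl (by fun_prop) hr fun z _ => ?_
    have h2 := Real.log_le_sub_one_of_pos (div_pos (hpos z) hApos)
    rw [Real.log_div (hpos z).ne' hApos.ne'] at h2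
    rw [inv_mul_eq_div]
    linarith
  have h3 : circleInt (fun z => A⁻¹ * u z + (Real.log A - 1)) r =
      A⁻¹ * circleInt u r + 2 * Real.pi * (Real.log A - 1) := by
    rw [← circleInt_const _ r]
    unfold circleInt
    rw [intervalIntegral.integral_add (Continuous.intervalIntegrable (by fun_prop) _ _)
      (Continuous.intervalIntegrable (by fun_prop) _ _), intervalIntegral.integral_const_mul]
  have h4 : circleInt u r = 2 * Real.pi * A := by
    rw [hA]; field_simp
  rw [h3, h4] at h1
  have h5 : A⁻¹ * (2 * Real.pi * A) = 2 * Real.pi := by field_simp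
  rw [h5] at h1
  linarith

section

variable {u ρ : ℂ → ℝ}

/-- With N = |∂u|², the identity reads `ddbar u` = u(ρ + u) + N/u. The gradient terms of the
regularized logarithm combine to δN/u ≥ 0, divided by (u + δ)², and are dropped. In the limit δ → 0
this discards the positive mass at the zeros of u. -/
lemma mul_div_le_ddbar_log (hu : ContDiff ℝ 2 u) (hu0 : ∀ z, 0 ≤ u z)
    (hid : ∀ z, u z ≠ 0 → u z * ddbar u z - Complex.normSq (del (fun w => (u w : ℂ)) z 1) =
      u z ^ 2 * (ρ z + u z)) {δ : ℝ} (hδ : 0 < δ) {z : ℂ} (hz : u z ≠ 0) :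
    u z / (u z + δ) * (ρ z + u z) ≤ ddbar (fun w => Real.log (u w + δ)) z := by
  have hpos : 0 < u z := lt_of_le_of_ne (hu0 z) hz.symm
  rw [ddbar_log_add hu (fun w => by linarith [hu0 w]), le_div_iff₀ (by positivity)]
  have h1 := hid z hz
  set N := Complex.normSq (del (fun w => (u w : ℂ)) z 1)
  have hN : 0 ≤ N := Complex.normSq_nonneg _
  have e : u z / (u z + δ) * (ρ z + u z) * (u z + δ) ^ 2 =
      (u z * (ρ z + u z)) * (u z + δ) := by
    have : u z + δ ≠ 0 := by positivity
    field_simp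
  have h2 : ddbar u z = u z * (ρ z + u z) + N / u z := by
    field_simp
    linarith
  rw [e, h2]
  have h3 : N / u z * u z = N := by field_simp
  have h4 : 0 ≤ N / u z * δ := by positivity
  nlinarith

/-- A bound of the circle means of `u` from below by the characteristic functions. -/
lemma exp_le_circleInt (hu : ContDiff ℝ 2 u) (hu0 : ∀ z, 0 ≤ u z) (hZ : {z | u z = 0}.Countable)
    (hρ : LocallyIntegrable ρ)
    (hid : ∀ z, u z ≠ 0 → u z * ddbar u z - Complex.normSq (del (fun w => (u w : ℂ)) z 1) =
      u z ^ 2 * (ρ z + u z)) {r₀ R c : ℝ} (hr₀ : 0 < r₀) (hR : r₀ ≤ R) (hc : 0 < c)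
    (hcu : ∀ z, ‖z‖ = r₀ → c ≤ u z) :
    c * Real.exp (2 / Real.pi * ∫ t in r₀..R, (∫ z in Metric.ball (0 : ℂ) t, (ρ z + u z)) / t) ≤
      circleInt u R / (2 * Real.pi) := by
  have huc := hu.continuous
  have hRpos : 0 < R := hr₀.trans_le hR
  have hg : LocallyIntegrable fun z => ρ z + u z := hρ.add huc.locallyIntegrable
  have hZae : ∀ᵐ z : ℂ, u z ≠ 0 := by
    have : volume {z | u z = 0} = 0 := hZ.measure_zero _
    exact measure_eq_zero_iff_ae_notMem.1 this
  set S := ∫ t in r₀..R, (∫ z in Metric.ball (0 : ℂ) t, (ρ z + u z)) / t with hS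
  -- Bounds, for all discs of radius at most R at once, the cost of replacing u/(u + δ) = 1 - δ/(u +
  -- δ) by 1. It tends to 0 with δ because u ≠ 0 almost everywhere.
  let η : ℝ → ℝ := fun δ => ∫ z in Metric.ball (0 : ℂ) R, δ / (u z + δ) * |ρ z + u z|
  have hIball : ∀ t, IntegrableOn (fun z => ρ z + u z) (Metric.ball (0 : ℂ) t) := fun t =>
    (hg.integrableOn_isCompact (isCompact_closedBall _ _)).mono_set Metric.ball_subset_closedBall
  have hfrac : ∀ δ, 0 < δ → ∀ z, 0 ≤ δ / (u z + δ) ∧ δ / (u z + δ) ≤ 1 := by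
    intro δ hδ z
    have h1 : 0 < u z + δ := by linarith [hu0 z]
    exact ⟨by positivity, (div_le_one h1).2 (by linarith [hu0 z])⟩
  have hIη : ∀ δ, 0 < δ → ∀ t,
      IntegrableOn (fun z => δ / (u z + δ) * |ρ z + u z|) (Metric.ball (0 : ℂ) t) := by
    intro δ hδ t
    have hcont : Continuous fun z => δ / (u z + δ) :=
      continuous_const.div (huc.add continuous_const) fun z => by linarith [hu0 z]
    refine (hIball t).abs.bdd_mul (c := 1) hcont.aestronglyMeasurable
      (Eventually.of_forall fun z => ?_)
    rw [Real.norm_of_nonneg (hfrac δ hδ z).1]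
    exact (hfrac δ hδ z).2
  have hη : Tendsto η (𝓝[>] 0) (𝓝 0) := by
    have h0 : ∫ z in Metric.ball (0 : ℂ) R, (0 : ℝ) = 0 := by simp
    suffices h : Tendsto η (𝓝[>] 0) (𝓝 (∫ z in Metric.ball (0 : ℂ) R, (0 : ℝ))) by
      rwa [h0] at h
    refine tendsto_integral_filter_of_dominated_convergence (fun z => |ρ z + u z|) ?_ ?_ ?_ ?_
    · filter_upwards [self_mem_nhdsWithin] with δ hδ using (hIη δ hδ R).aestronglyMeasurable
    · filter_upwards [self_mem_nhdsWithin] with δ hδ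
      refine Eventually.of_forall fun z => ?_
      rw [norm_mul, Real.norm_of_nonneg (hfrac δ hδ z).1, Real.norm_eq_abs, abs_abs]
      exact mul_le_of_le_one_left (abs_nonneg _) (hfrac δ hδ z).2
    · exact (hIball R).abs
    · filter_upwards [ae_restrict_of_ae hZae] with z hz
      have h1 : Tendsto (fun δ : ℝ => δ / (u z + δ) * |ρ z + u z|) (𝓝 0)
          (𝓝 (0 / (u z + 0) * |ρ z + u z|)) := by
        apply ContinuousAt.tendsto (f := fun δ : ℝ => δ / (u z + δ) * |ρ z + u z|)
        apply ContinuousAt.mul _ continuousAt_const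
        exact continuousAt_id.div (continuousAt_const.add continuousAt_id) (by simpa using hz)
      simp only [zero_div, zero_mul] at h1
      exact h1.mono_left nhdsWithin_le_nhds
  have main : ∀ δ, 0 < δ → c * Real.exp (2 / Real.pi * (S - η δ * Real.log (R / r₀))) ≤
      circleInt u R / (2 * Real.pi) + δ := by
    intro δ hδ
    have hpos : ∀ z, 0 < u z + δ := fun z => by linarith [hu0 z]
    have hφ : ContDiff ℝ 2 fun w => Real.log (u w + δ) :=
      (hu.add contDiff_const).log fun z => (hpos z).ne'
    have hdd := continuous_ddbar hφ
    have hball : ∀ t ∈ Icc r₀ R, (∫ z in Metric.ball (0 : ℂ) t, (ρ z + u z)) / t - η δ * t⁻¹ ≤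
        (∫ z in Metric.ball (0 : ℂ) t, ddbar (fun w => Real.log (u w + δ)) z) / t := by
      intro t ht
      have ht0 : 0 < t := hr₀.trans_le ht.1
      rw [← div_eq_mul_inv, ← sub_div]
      refine div_le_div_of_nonneg_right ?_ ht0.le
      have h1 : (∫ z in Metric.ball (0 : ℂ) t, δ / (u z + δ) * |ρ z + u z|) ≤ η δ :=
        setIntegral_mono_set (hIη δ hδ R)
          (Eventually.of_forall fun z => mul_nonneg (hfrac δ hδ z).1 (abs_nonneg _))
          (Metric.ball_subset_ball ht.2).eventuallyLE
      have h2 : (∫ z in Metric.ball (0 : ℂ) t, ((ρ z + u z) - δ / (u z + δ) * |ρ z + u z|)) ≤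
          ∫ z in Metric.ball (0 : ℂ) t, ddbar (fun w => Real.log (u w + δ)) z := by
        refine integral_mono_ae ((hIball t).sub (hIη δ hδ t))
          ((hdd.continuousOn.integrableOn_compact (isCompact_closedBall _ _)).mono_set
            Metric.ball_subset_closedBall) ?_
        filter_upwards [ae_restrict_of_ae hZae] with z hz
        refine le_trans ?_ (mul_div_le_ddbar_log hu hu0 hid hδ hz)
        have h3 : u z / (u z + δ) = 1 - δ / (u z + δ) := by
          have := (hpos z).ne'
          field_simp
          ring
        rw [h3]
        have := mul_le_mul_of_nonneg_left (le_abs_self (ρ z + u z)) (hfrac δ hδ z).1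
        linarith
      rw [integral_sub (hIball t) (hIη δ hδ t)] at h2
      linarith
    -- The logarithm is the integral of 1/t against the uniform error η δ.
    have h1 : S - η δ * Real.log (R / r₀) ≤
        ∫ t in r₀..R, (∫ z in Metric.ball (0 : ℂ) t,
          ddbar (fun w => Real.log (u w + δ)) z) / t := by
      have hinv : IntervalIntegrable (fun t : ℝ => η δ * t⁻¹) volume r₀ R :=
        (intervalIntegral.intervalIntegrable_inv (fun t ht => by
          rw [uIcc_of_le hR] at ht
          exact (hr₀.trans_le ht.1).ne') continuousOn_id).const_mul _
      have h2 := intervalIntegral.integral_mono_on hR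
        ((intervalIntegrable_setIntegral_ball_div hg hr₀ hRpos).sub hinv)
        (intervalIntegrable_setIntegral_ball_div hdd.locallyIntegrable hr₀ hRpos) hball
      rw [intervalIntegral.integral_sub (intervalIntegrable_setIntegral_ball_div hg hr₀ hRpos) hinv,
        intervalIntegral.integral_const_mul, integral_inv_of_pos hr₀ hRpos] at h2
      exact h2
    have h2 := circleInt_sub_circleInt hφ hr₀ hR
    have h3 := circleInt_log_le (u := fun z => u z + δ) (by fun_prop) hpos hRpos.le
    have h4 : circleInt (fun z => u z + δ) R / (2 * Real.pi) =
        circleInt u R / (2 * Real.pi) + δ := by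
      have : circleInt (fun z => u z + δ) R = circleInt u R + 2 * Real.pi * δ := by
        rw [← circleInt_const δ R]
        unfold circleInt
        rw [intervalIntegral.integral_add (Continuous.intervalIntegrable (by fun_prop) _ _)
          (Continuous.intervalIntegrable (by fun_prop) _ _)]
      rw [this]
      field_simp
    have h5 : 2 * Real.pi * Real.log c ≤ circleInt (fun w => Real.log (u w + δ)) r₀ := by
      rw [← circleInt_const _ r₀]
      refine circleInt_mono continuous_const hφ.continuous hr₀.le fun z hz => ?_
      exact Real.log_le_log hc (by linarith [hcu z hz])
    have hm : 0 ≤ circleInt u R := by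
      unfold circleInt
      exact intervalIntegral.integral_nonneg (by linarith [Real.pi_pos]) fun θ _ => hu0 _
    rw [h4] at h3
    have hπ := Real.pi_pos
    have hmpos : 0 < circleInt u R / (2 * Real.pi) + δ := by positivity
    rw [← Real.log_le_log_iff (by positivity) hmpos, Real.log_mul hc.ne' (Real.exp_pos _).ne',
      Real.log_exp]
    -- The exponent 2/π is the 4 of Jensen's formula divided by the length 2π of the angle interval.
    have h6 : Real.pi * (2 / Real.pi * (S - η δ * Real.log (R / r₀))) =
        2 * (S - η δ * Real.log (R / r₀)) := by field_simp
    refine le_of_mul_le_mul_left ?_ hπ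
    rw [mul_add, h6]
    linarith
  have hL : Tendsto (fun δ => c * Real.exp (2 / Real.pi * (S - η δ * Real.log (R / r₀)))) (𝓝[>] 0)
      (𝓝 (c * Real.exp (2 / Real.pi * (S - 0 * Real.log (R / r₀))))) :=
    ((Real.continuous_exp.tendsto _).comp
      ((tendsto_const_nhds.sub (hη.mul_const _)).const_mul _)).const_mul _
  have hRt : Tendsto (fun δ : ℝ => circleInt u R / (2 * Real.pi) + δ) (𝓝[>] 0)
      (𝓝 (circleInt u R / (2 * Real.pi) + 0)) :=
    (tendsto_const_nhds.add tendsto_id).mono_left nhdsWithin_le_nhds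
  have := le_of_tendsto_of_tendsto hL hRt (by
    filter_upwards [self_mem_nhdsWithin] with δ hδ using main δ hδ)
  simpa using this

/-- A lower bound B of `characteristic ρ` turns `exp_le_circleInt` into m ≥ a exp((2/π)T), where m
is the circle integral of u and T is its characteristic function started at r₀. Since T' = U/r and
U' = r m, with U the integral of u over the disc, `false_of_exp_le` applies. -/
theorem not_bddBelow_characteristic (hu : ContDiff ℝ 2 u) (hu0 : ∀ z, 0 ≤ u z)
    (hZ : {z | u z = 0}.Countable) (hρ : LocallyIntegrable ρ)
    (hid : ∀ z, u z ≠ 0 → u z * ddbar u z - Complex.normSq (del (fun w => (u w : ℂ)) z 1) =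
      u z ^ 2 * (ρ z + u z)) :
    ¬ BddBelow (characteristic ρ '' Ici 1) := by
  rintro ⟨B, hB⟩
  have huc := hu.continuous
  -- The moduli of the zeros are countable, so some circle avoids them and u has a positive minimum
  -- there. The condition r₀ ≥ 1 serves both `characteristic` and the blow-up lemma.
  obtain ⟨r₀, hr₀, hr₀Z⟩ : ∃ r₀ ∈ Icc (1 : ℝ) 2, r₀ ∉ (fun z : ℂ => ‖z‖) '' {z | u z = 0} := by
    by_contra! hcon
    exact (Cardinal.Real.Icc_countable_iff.not.2 (by norm_num))
      ((hZ.image fun z : ℂ => ‖z‖).mono hcon)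
  have h0 : 0 < r₀ := by linarith [hr₀.1]
  have hne : ∀ z, ‖z‖ = r₀ → u z ≠ 0 := fun z hz h => hr₀Z ⟨z, h, hz⟩
  obtain ⟨c, hc, hcu⟩ : ∃ c : ℝ, 0 < c ∧ ∀ z, ‖z‖ = r₀ → c ≤ u z := by
    obtain ⟨x, hx, hmin⟩ := (isCompact_sphere (0 : ℂ) r₀).exists_isMinOn
      (NormedSpace.sphere_nonempty.2 h0.le) huc.continuousOn
    have hx' : ‖x‖ = r₀ := by simpa using hx
    exact ⟨u x, lt_of_le_of_ne (hu0 x) (hne x hx').symm, fun z hz => hmin (by simpa using hz)⟩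
  let U : ℝ → ℝ := fun r => ∫ s in (0 : ℝ)..r, s * circleInt u s
  have hUball : ∀ r, 0 ≤ r → ∫ z in Metric.ball (0 : ℂ) r, u z = U r := fun r hr =>
    setIntegral_ball_eq huc hr
  have hUc : Continuous fun s => s * circleInt u s := continuous_id.mul (continuous_circleInt huc)
  have hUd : ∀ r, HasDerivAt U (r * circleInt u r) r := fun r =>
    intervalIntegral.integral_hasDerivAt_right (hUc.intervalIntegrable _ _)
      (hUc.stronglyMeasurableAtFilter _ _) hUc.continuousAt
  have hUcont : Continuous U := continuous_iff_continuousAt.2 fun r => (hUd r).continuousAt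
  let T : ℝ → ℝ := fun r => ∫ t in r₀..r, U t / t
  have hTd : ∀ r, r₀ ≤ r → HasDerivAt T (U r / r) r := by
    intro r hr
    have hr0 : 0 < r := h0.trans_le hr
    have hcont : ContinuousOn (fun t => U t / t) (Ioi 0) :=
      hUcont.continuousOn.div continuousOn_id fun t ht => (ne_of_gt ht)
    refine intervalIntegral.integral_hasDerivAt_right ?_ ?_ ?_
    · refine (hcont.mono fun t ht => ?_).intervalIntegrable
      exact (lt_min h0 hr0).trans_le ht.1
    · exact hcont.stronglyMeasurableAtFilter isOpen_Ioi r hr0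
    · exact hcont.continuousAt (Ioi_mem_nhds hr0)
  have hint : ∀ a b : ℝ, 0 < a → 0 < b →
      IntervalIntegrable (fun t => (∫ z in Metric.ball (0 : ℂ) t, ρ z) / t) volume a b :=
    fun a b ha hb => intervalIntegrable_setIntegral_ball_div hρ ha hb
  have hS : ∀ r, r₀ ≤ r → ∫ t in r₀..r, (∫ z in Metric.ball (0 : ℂ) t, (ρ z + u z)) / t =
      characteristic ρ r - characteristic ρ r₀ + T r := by
    intro r hr
    have hr0 : 0 < r := h0.trans_le hr
    have h1 : characteristic ρ r - characteristic ρ r₀ =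
        ∫ t in r₀..r, (∫ z in Metric.ball (0 : ℂ) t, ρ z) / t :=
      intervalIntegral.integral_interval_sub_left (hint _ _ one_pos hr0) (hint _ _ one_pos h0)
    have h2 : T r = ∫ t in r₀..r, (∫ z in Metric.ball (0 : ℂ) t, u z) / t := by
      refine intervalIntegral.integral_congr fun t ht => ?_
      rw [uIcc_of_le hr] at ht
      rw [hUball t (h0.le.trans ht.1)]
    rw [h1, h2, ← intervalIntegral.integral_add (hint _ _ h0 hr0)
      (intervalIntegrable_setIntegral_ball_div huc.locallyIntegrable h0 hr0)]
    refine intervalIntegral.integral_congr fun t ht => ?_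
    rw [← add_div, integral_add]
    · exact (hρ.integrableOn_isCompact (isCompact_closedBall _ _)).mono_set
        Metric.ball_subset_closedBall
    · exact (huc.locallyIntegrable.integrableOn_isCompact (isCompact_closedBall _ _)).mono_set
        Metric.ball_subset_closedBall
  have hπ := Real.pi_pos
  refine false_of_exp_le (m := circleInt u) (U := U) (T := T)
    (a := 2 * Real.pi * (c * Real.exp (2 / Real.pi * (B - characteristic ρ r₀))))
    (b := 2 / Real.pi) (r₀ := r₀) (by positivity) (by positivity) hr₀.1 (fun r _ => hUd r) hTd ?_ ?_
  · rw [← hUball r₀ h0.le, setIntegral_pos_iff_support_of_nonneg_ae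
      (Eventually.of_forall hu0)
      ((huc.locallyIntegrable.integrableOn_isCompact (isCompact_closedBall _ _)).mono_set
        Metric.ball_subset_closedBall)]
    have h1 : Function.support u ∩ Metric.ball 0 r₀ = Metric.ball 0 r₀ \ {z | u z = 0} := by
      ext z; simp [and_comm]
    rw [h1, measure_sdiff_null (hZ.measure_zero _)]
    exact Metric.measure_ball_pos _ _ h0
  · intro r hr
    have h1 := exp_le_circleInt hu hu0 hZ hρ hid h0 hr hc hcu
    rw [hS r hr, le_div_iff₀ (by positivity)] at h1
    refine le_trans ?_ h1
    have h2 : B ≤ characteristic ρ r := hB ⟨r, hr₀.1.trans hr, rfl⟩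
    have h3 : Real.exp (2 / Real.pi * (B - characteristic ρ r₀)) * Real.exp (2 / Real.pi * T r) ≤
        Real.exp (2 / Real.pi * (characteristic ρ r - characteristic ρ r₀ + T r)) := by
      rw [← Real.exp_add, Real.exp_le_exp, ← mul_add]
      exact mul_le_mul_of_nonneg_left (by linarith) (by positivity)
    have h4 := mul_le_mul_of_nonneg_left h3 (by positivity : 0 ≤ 2 * Real.pi * c)
    linarith

end

end PeriodCurve

namespace PeriodCurve

variable {V : Type*} [NormedAddCommGroup V] [NormedSpace ℂ V]

/-! ## Algebra of the curvature form -/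

section CurvForm

variable {h : SesqForm V} {v : V}

lemma curvForm_add_left (a a' b : V) :
    curvForm h v (a + a') b = curvForm h v a b + curvForm h v a' b := by
  simp only [curvForm, map_add, LinearMap.add_apply]; ring

lemma curvForm_sub_left (a a' b : V) :
    curvForm h v (a - a') b = curvForm h v a b - curvForm h v a' b := by
  simp only [curvForm, map_sub, LinearMap.sub_apply]; ring

lemma curvForm_smul_left (c : ℂ) (a b : V) :
    curvForm h v (c • a) b = c * curvForm h v a b := by
  simp only [curvForm, map_smul, LinearMap.smul_apply, smul_eq_mul]; ring

lemma curvForm_add_right (a b b' : V) :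
    curvForm h v a (b + b') = curvForm h v a b + curvForm h v a b' := by
  simp only [curvForm, map_add]; ring

lemma curvForm_sub_right (a b b' : V) :
    curvForm h v a (b - b') = curvForm h v a b - curvForm h v a b' := by
  simp only [curvForm, map_sub]; ring

lemma curvForm_smul_right (c : ℂ) (a b : V) :
    curvForm h v a (c • b) = (starRingEnd ℂ) c * curvForm h v a b := by
  simp only [curvForm, LinearMap.map_smulₛₗ, smul_eq_mul]; ring

lemma curvForm_self_left (b : V) : curvForm h v v b = 0 := by
  simp only [curvForm]; ring

lemma conj_curvForm (hh : IsHermitianForm h) (a b : V) :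
    (starRingEnd ℂ) (curvForm h v a b) = curvForm h v b a := by
  simp only [curvForm, map_mul, map_div₀, map_sub, map_pow, hh _ _, map_neg, Complex.conj_ofNat]
  ring

lemma ofReal_re_curvForm (hh : IsHermitianForm h) (a : V) :
    ((curvForm h v a a).re : ℂ) = curvForm h v a a :=
  Complex.conj_eq_iff_re.1 (conj_curvForm hh a a)

/-- Up to the factor -2/h(v, v), `curvForm h v a b` is the pairing of b with the component of a
orthogonal to v. So nondegeneracy of h on V gives nondegeneracy of ω on V/ℂv. -/
lemma eq_smul_of_curvForm_eq_zero (hnd : ∀ x, (∀ y, h x y = 0) → x = 0) (hv : h v v ≠ 0) {a : V}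
    (ha : ∀ b, curvForm h v a b = 0) : ∃ d : ℂ, a = d • v := by
  refine ⟨h a v / h v v, sub_eq_zero.1 (hnd _ fun b => ?_)⟩
  have h1 := ha b
  simp only [curvForm, mul_eq_zero, neg_eq_zero, OfNat.ofNat_ne_zero, false_or,
    div_eq_zero_iff, pow_eq_zero_iff, ne_eq, not_false_eq_true, hv, or_false] at h1
  simp only [map_sub, map_smul, LinearMap.sub_apply, LinearMap.smul_apply, smul_eq_mul]
  field_simp
  linear_combination h1

/-- The squared norm of the component of `b` orthogonal to `a`, divided by that of `a`. -/
noncomputable def orthRatio (h : SesqForm V) (v a b : V) : ℂ :=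
  (curvForm h v b b * curvForm h v a a - curvForm h v b a * curvForm h v a b) /
    curvForm h v a a ^ 2

/-- If F' = μG then F'' = μ'G + μG'. The term μ'G has no component orthogonal to G, and |μ|²
cancels; this is what carries ‖ψ‖² across the zeros of F'. -/
lemma orthRatio_smul_add {μ μ' : ℂ} (hμ : μ ≠ 0) (a b : V) :
    orthRatio h v (μ • a) (μ' • a + μ • b) = orthRatio h v a b := by
  have hμ' : (starRingEnd ℂ) μ ≠ 0 := by simpa using hμ
  simp only [orthRatio, curvForm_add_left, curvForm_add_right, curvForm_smul_left,
    curvForm_smul_right]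
  by_cases hc : curvForm h v a a = 0
  · simp [hc]
  · field_simp
    ring

end CurvForm

/-! ## Tangent vectors -/

/-- The tangent vector that maps the vector `v ∈ l` with `ℓ v = 1` to the class of `a`. -/
noncomputable def tanOf (l : ℙ ℂ V) (ℓ : V →L[ℂ] ℂ) (a : V) : Tan l :=
  ((ℓ : V →ₗ[ℂ] ℂ).comp l.submodule.subtype).smulRight (Submodule.Quotient.mk a)

section TanOf

variable {l : ℙ ℂ V} {ℓ : V →L[ℂ] ℂ} {v : V}

lemma tanOf_apply (hv : v ∈ l.submodule) (hℓ : ℓ v = 1) (a : V) :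
    tanOf l ℓ a ⟨v, hv⟩ = Submodule.Quotient.mk a := by
  simp [tanOf, hℓ]

lemma tan_ext (hv : v ∈ l.submodule) (hv0 : v ≠ 0) {u u' : Tan l} (h : u ⟨v, hv⟩ = u' ⟨v, hv⟩) :
    u = u' := by
  ext ⟨x, hx⟩
  have h2 := hx
  rw [l.submodule_eq] at h2
  have h3 := hv
  rw [l.submodule_eq] at h3
  obtain ⟨c, rfl⟩ := Submodule.mem_span_singleton.1 h2
  obtain ⟨d, hd⟩ := Submodule.mem_span_singleton.1 h3
  have hd0 : d ≠ 0 := by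
    rintro rfl; exact hv0 (by rw [← hd, zero_smul])
  have e : (⟨c • l.rep, hx⟩ : l.submodule) = (c / d) • ⟨v, hv⟩ := by
    apply Subtype.ext
    simp only [SetLike.mk_smul_mk]
    rw [← hd, smul_smul, div_mul_cancel₀ _ hd0]
  rw [e, map_smul, map_smul, h]

lemma ne_zero_of_apply_eq_one (hℓ : ℓ v = 1) : v ≠ 0 := by
  rintro rfl; simp at hℓ

lemma eq_tanOf_iff (hv : v ∈ l.submodule) (hℓ : ℓ v = 1) {u : Tan l} {a : V} :
    u = tanOf l ℓ a ↔ u ⟨v, hv⟩ = Submodule.Quotient.mk a := by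
  constructor
  · rintro rfl; exact tanOf_apply hv hℓ a
  · intro h
    exact tan_ext hv (ne_zero_of_apply_eq_one hℓ) (h.trans (tanOf_apply hv hℓ a).symm)

lemma exists_eq_tanOf (hv : v ∈ l.submodule) (hℓ : ℓ v = 1) (u : Tan l) : ∃ a, u = tanOf l ℓ a := by
  obtain ⟨a, ha⟩ := Submodule.Quotient.mk_surjective _ (u ⟨v, hv⟩)
  exact ⟨a, (eq_tanOf_iff hv hℓ).2 ha.symm⟩

lemma tanOf_add (a b : V) : tanOf l ℓ (a + b) = tanOf l ℓ a + tanOf l ℓ b := by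
  ext x; simp [tanOf]

lemma tanOf_sub (a b : V) : tanOf l ℓ (a - b) = tanOf l ℓ a - tanOf l ℓ b := by
  ext x; simp [tanOf, smul_sub]

lemma tanOf_smul (c : ℂ) (a : V) : tanOf l ℓ (c • a) = c • tanOf l ℓ a := by
  ext x; simp [tanOf, smul_comm c]

lemma tanOf_self (hv : v ∈ l.submodule) : tanOf l ℓ v = 0 := by
  ext x; simp [tanOf, (Submodule.Quotient.mk_eq_zero _).2 hv]

lemma tanOf_eq_tanOf (hv : v ∈ l.submodule) (hℓ : ℓ v = 1) {a b : V}
    (h : tanOf l ℓ a = tanOf l ℓ b) : ∃ d : ℂ, a = b + d • v := by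
  rw [eq_tanOf_iff hv hℓ, tanOf_apply hv hℓ] at h
  exact mk_eq_mk_of_smul hv (ne_zero_of_apply_eq_one hℓ) h

variable [FiniteDimensional ℂ V] {h : SesqForm V}

lemma omega_tanOf (hh : IsHermitianForm h) (hl : l ∈ positiveDomain h) (hv : v ∈ l.submodule)
    (hℓ : ℓ v = 1) (a b : V) :
    omega h l (tanOf l ℓ a) (tanOf l ℓ b) = curvForm h v a b :=
  tautCurvature_eq hh hl hv (ne_zero_of_apply_eq_one hℓ) (tanOf_apply hv hℓ a)
    (tanOf_apply hv hℓ b)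

end TanOf

/-! ## Normalized lifts -/

/-- `F` is a holomorphic lift of `f` near `z` with `ℓ ∘ F = 1`. -/
structure IsNormalizedLiftAt (f : ℂ → ℙ ℂ V) (ℓ : V →L[ℂ] ℂ) (F : ℂ → V) (z : ℂ) : Prop where
  analyticAt : AnalyticAt ℂ F z
  mem_submodule : ∀ᶠ w in 𝓝 z, F w ∈ (f w).submodule
  apply_eq_one : ∀ᶠ w in 𝓝 z, ℓ (F w) = 1

section Lifts

variable {f : ℂ → ℙ ℂ V} {ℓ : V →L[ℂ] ℂ} {F : ℂ → V} {z : ℂ}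

lemma IsNormalizedLiftAt.isLiftAt (hF : IsNormalizedLiftAt f ℓ F z) : IsLiftAt f F z := by
  refine ⟨hF.analyticAt, ?_⟩
  filter_upwards [hF.mem_submodule, hF.apply_eq_one] with w h1 h2
  exact ⟨ne_zero_of_apply_eq_one h2, h1⟩

lemma IsLiftAt.exists_smul_eq (hF : IsNormalizedLiftAt f ℓ F z) {F' : ℂ → V}
    (hF' : IsLiftAt f F' z) : ∀ᶠ w in 𝓝 z, ℓ (F' w) ≠ 0 ∧ F' w = ℓ (F' w) • F w := by
  filter_upwards [hF.mem_submodule, hF.apply_eq_one, hF'.2] with w h1 h2 h3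
  have h4 := h3.2
  rw [(f w).submodule_eq] at h1 h4
  obtain ⟨c, hc⟩ := Submodule.mem_span_singleton.1 h1
  obtain ⟨d, hd⟩ := Submodule.mem_span_singleton.1 h4
  have hc0 : c ≠ 0 := by
    rintro rfl; exact ne_zero_of_apply_eq_one h2 (by rw [← hc, zero_smul])
  have h5 : F' w = (d / c) • F w := by
    rw [← hd, ← hc, smul_smul, div_mul_cancel₀ _ hc0]
  have h6 : ℓ (F' w) = d / c := by rw [h5, map_smul, h2]; simp
  rw [h6]
  refine ⟨fun h0 => h3.1 ?_, h5⟩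
  rw [h5, h0, zero_smul]

/-- Divide a lift by a functional that does not vanish on it at z. The normalization removes the
freedom of rescaling, so that f is locally constant exactly when F is. -/
lemma IsHolomorphicCurve.exists_normalizedLift (hf : IsHolomorphicCurve f) (z : ℂ) :
    ∃ (ℓ : V →L[ℂ] ℂ) (F : ℂ → V), IsNormalizedLiftAt f ℓ F z := by
  obtain ⟨F, hFa, hF⟩ := hf z
  obtain ⟨ℓ, hℓ⟩ := SeparatingDual.exists_eq_one (R := ℂ) hF.self_of_nhds.1
  have hℓF : AnalyticAt ℂ (fun w => ℓ (F w)) z := (ℓ.analyticAt _).comp hFa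
  have hne : ℓ (F z) ≠ 0 := by rw [hℓ]; exact one_ne_zero
  refine ⟨ℓ, fun w => (ℓ (F w))⁻¹ • F w, (hℓF.inv hne).smul hFa, ?_, ?_⟩
  · filter_upwards [hF] with w hw
    exact Submodule.smul_mem _ _ hw.2
  · filter_upwards [hℓF.continuousAt.eventually_ne hne] with w hw
    simp [hw]

lemma IsNormalizedLiftAt.apply_deriv (hF : IsNormalizedLiftAt f ℓ F z) : ℓ (deriv F z) = 0 := by
  have h1 : HasDerivAt (fun w => ℓ (F w)) (ℓ (deriv F z)) z :=
    ℓ.hasFDerivAt.comp_hasDerivAt z hF.analyticAt.differentiableAt.hasDerivAt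
  have h2 : HasDerivAt (fun w => ℓ (F w)) 0 z :=
    (hasDerivAt_const z (1 : ℂ)).congr_of_eventuallyEq hF.apply_eq_one
  exact h1.unique h2

/-- Any other lift is gF with g nonvanishing, and (gF)' ≡ gF' modulo F; hence the condition defining
`velocity` has a unique solution. -/
lemma IsNormalizedLiftAt.velocity_eq (hF : IsNormalizedLiftAt f ℓ F z) :
    velocity f z = tanOf (f z) ℓ (deriv F z) := by
  have hm := hF.mem_submodule.self_of_nhds
  have h1 := hF.apply_eq_one.self_of_nhds
  have hspec : ∃ F', IsLiftAt f F' z ∧ ∃ hF' : F' z ∈ (f z).submodule,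
      velocity f z ⟨F' z, hF'⟩ = Submodule.Quotient.mk (deriv F' z) :=
    Classical.epsilon_spec (p := fun u : Tan (f z) => ∃ F, IsLiftAt f F z ∧
      ∃ hF : F z ∈ (f z).submodule, u ⟨F z, hF⟩ = Submodule.Quotient.mk (deriv F z))
      ⟨tanOf (f z) ℓ (deriv F z), F, hF.isLiftAt, hm, tanOf_apply hm h1 _⟩
  obtain ⟨F', hF', hm', hvel⟩ := hspec
  have hev := IsLiftAt.exists_smul_eq hF hF'
  obtain ⟨hne, hz⟩ := hev.self_of_nhds
  have hd : HasDerivAt F' (ℓ (F' z) • deriv F z + ℓ (deriv F' z) • F z) z := by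
    have h2 : HasDerivAt (fun w => ℓ (F' w)) (ℓ (deriv F' z)) z :=
      ℓ.hasFDerivAt.comp_hasDerivAt z hF'.1.differentiableAt.hasDerivAt
    exact (h2.smul hF.analyticAt.differentiableAt.hasDerivAt).congr_of_eventuallyEq
      (hev.mono fun w hw => hw.2)
  rw [eq_tanOf_iff hm h1]
  have e : (⟨F' z, hm'⟩ : (f z).submodule) = ℓ (F' z) • ⟨F z, hm⟩ := Subtype.ext hz
  rw [e, map_smul, hd.deriv, Submodule.Quotient.mk_add, Submodule.Quotient.mk_smul,
    Submodule.Quotient.mk_smul, (Submodule.Quotient.mk_eq_zero _).2 hm, smul_zero, add_zero] at hvel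
  exact smul_right_injective _ hne hvel

lemma IsNormalizedLiftAt.isHolSectionAt_iff (hF : IsNormalizedLiftAt f ℓ F z)
    {s : ∀ w, Tan (f w)} :
    IsHolSectionAt f s z ↔
      ∃ A : ℂ → V, AnalyticAt ℂ A z ∧ ∀ᶠ w in 𝓝 z, s w = tanOf (f w) ℓ (A w) := by
  constructor
  · rintro ⟨F', A, hF', hA, hs⟩
    have hev := IsLiftAt.exists_smul_eq hF hF'
    have hℓF : AnalyticAt ℂ (fun w => ℓ (F' w)) z := (ℓ.analyticAt _).comp hF'.1
    refine ⟨fun w => (ℓ (F' w))⁻¹ • A w, (hℓF.inv hev.self_of_nhds.1).smul hA, ?_⟩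
    filter_upwards [hev, hs, hF.mem_submodule, hF.apply_eq_one] with w h1 h2 h3 h4
    obtain ⟨hm, h2⟩ := h2
    rw [eq_tanOf_iff h3 h4]
    have e : (⟨F w, h3⟩ : (f w).submodule) = (ℓ (F' w))⁻¹ • ⟨F' w, hm⟩ := by
      apply Subtype.ext
      simp only [SetLike.mk_smul_mk]
      conv_rhs => rw [h1.2]
      simp [h4, smul_smul, inv_mul_cancel₀ h1.1]
    rw [e, map_smul, h2, Submodule.Quotient.mk_smul]
  · rintro ⟨A, hA, hs⟩
    refine ⟨F, A, hF.isLiftAt, hA, ?_⟩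
    filter_upwards [hs, hF.mem_submodule, hF.apply_eq_one] with w h1 h2 h3
    exact ⟨h2, (eq_tanOf_iff h2 h3).1 h1⟩

lemma IsNormalizedLiftAt.eq_of_apply_eq {w w' : ℂ} (hw : F w ∈ (f w).submodule)
    (hw' : F w' ∈ (f w').submodule) (h1 : ℓ (F w) = 1) (h2 : ℓ (F w') = 1) :
    f w = f w' ↔ F w = F w' := by
  constructor
  · intro h
    rw [← h] at hw'
    rw [(f w).submodule_eq] at hw hw'
    obtain ⟨c, hc⟩ := Submodule.mem_span_singleton.1 hw
    obtain ⟨d, hd⟩ := Submodule.mem_span_singleton.1 hw'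
    rw [← hc, map_smul, smul_eq_mul] at h1
    rw [← hd, map_smul, smul_eq_mul] at h2
    have h3 : ℓ (f w).rep ≠ 0 := by
      intro h0; rw [h0] at h1; simp at h1
    have : c = d := mul_right_cancel₀ h3 (h1.trans h2.symm)
    rw [← hc, ← hd, this]
  · intro h
    rw [← h] at hw'
    apply Projectivization.submodule_injective
    have key : ∀ l : ℙ ℂ V, F w ∈ l.submodule → l.submodule = Submodule.span ℂ {F w} := by
      intro l hl
      rw [l.submodule_eq] at hl ⊢
      obtain ⟨c, hc⟩ := Submodule.mem_span_singleton.1 hl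
      have hc0 : c ≠ 0 := by
        rintro rfl; exact ne_zero_of_apply_eq_one h1 (by rw [← hc, zero_smul])
      rw [← hc, Submodule.span_singleton_smul_eq (IsUnit.mk0 _ hc0)]
    rw [key _ hw, key _ hw']

variable [FiniteDimensional ℂ V]

lemma IsNormalizedLiftAt.eventually (hF : IsNormalizedLiftAt f ℓ F z) :
    ∀ᶠ w in 𝓝 z, IsNormalizedLiftAt f ℓ F w := by
  have : CompleteSpace V := FiniteDimensional.complete ℂ V
  filter_upwards [hF.analyticAt.eventually_analyticAt, hF.mem_submodule.eventually_nhds,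
    hF.apply_eq_one.eventually_nhds] with w h1 h2 h3
  exact ⟨h1, h2, h3⟩

lemma IsNormalizedLiftAt.analyticAt_deriv (hF : IsNormalizedLiftAt f ℓ F z) :
    AnalyticAt ℂ (deriv F) z := by
  have : CompleteSpace V := FiniteDimensional.complete ℂ V
  exact hF.analyticAt.deriv

lemma IsNormalizedLiftAt.eventually_const_iff (hF : IsNormalizedLiftAt f ℓ F z) :
    (∀ᶠ w in 𝓝 z, f w = f z) ↔ ∀ᶠ w in 𝓝 z, deriv F w = 0 := by
  have : CompleteSpace V := FiniteDimensional.complete ℂ V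
  have h1 : (∀ᶠ w in 𝓝 z, f w = f z) ↔ ∀ᶠ w in 𝓝 z, F w = F z := by
    apply eventually_congr
    filter_upwards [hF.mem_submodule, hF.apply_eq_one] with w h1 h2
    exact IsNormalizedLiftAt.eq_of_apply_eq h1 hF.mem_submodule.self_of_nhds h2
      hF.apply_eq_one.self_of_nhds
  rw [h1]
  constructor
  · intro h
    filter_upwards [h.eventually_nhds] with w hw
    have : F =ᶠ[𝓝 w] fun _ => F z := hw
    rw [this.deriv_eq]; simp
  · intro h
    obtain ⟨r, hr, hball⟩ := Metric.eventually_nhds_iff_ball.1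
      (h.and hF.analyticAt.eventually_analyticAt)
    refine Metric.eventually_nhds_iff_ball.2 ⟨r, hr, fun w hw => ?_⟩
    exact Metric.isOpen_ball.is_const_of_deriv_eq_zero (convex_ball z r).isPreconnected
      (fun x hx => (hball x hx).2.differentiableAt.differentiableWithinAt)
      (fun x hx => (hball x hx).1) hw (Metric.mem_ball_self hr)

/-- The identity theorem: the set where f is locally constant is open, and it is closed because the
zeros of a nonzero F' are isolated. -/
lemma IsHolomorphicCurve.not_eventually_const (hf : IsHolomorphicCurve f)
    (hfnc : ∃ z w, f z ≠ f w) (z : ℂ) : ¬ ∀ᶠ w in 𝓝 z, f w = f z := by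
  have hopen : IsOpen {z | ∀ᶠ w in 𝓝 z, f w = f z} := by
    rw [isOpen_iff_mem_nhds]
    intro x (hx : ∀ᶠ w in 𝓝 x, f w = f x)
    filter_upwards [hx.eventually_nhds] with y hy
    have := hy.self_of_nhds
    filter_upwards [hy] with w hw
    rw [hw, this]
  have hclosed : IsClosed {z | ∀ᶠ w in 𝓝 z, f w = f z} := by
    rw [← isOpen_compl_iff, isOpen_iff_mem_nhds]
    intro x (hx : ¬ ∀ᶠ w in 𝓝 x, f w = f x)
    obtain ⟨ℓ, F, hF⟩ := hf.exists_normalizedLift x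
    have h1 : ∀ᶠ w in 𝓝[≠] x, deriv F w ≠ 0 :=
      hF.analyticAt_deriv.eventually_eq_zero_or_eventually_ne_zero.resolve_left
        (fun h => hx (hF.eventually_const_iff.2 h))
    rw [eventually_nhdsWithin_iff] at h1
    filter_upwards [h1, hF.eventually] with w h2 h3
    by_cases hw : w = x
    · rw [hw]; exact hx
    · intro h4
      exact h2 hw ((h3.eventually_const_iff.1 h4).self_of_nhds)
  intro hz
  have huniv : {z | ∀ᶠ w in 𝓝 z, f w = f z} = univ :=
    IsClopen.eq_univ ⟨hclosed, hopen⟩ ⟨z, hz⟩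
  have hlc : IsLocallyConstant f := (IsLocallyConstant.iff_eventually_eq f).2 fun x => by
    have : x ∈ {z | ∀ᶠ w in 𝓝 z, f w = f z} := by rw [huniv]; trivial
    exact this
  obtain ⟨a, b, hab⟩ := hfnc
  exact hab (hlc.apply_eq_of_isPreconnected isPreconnected_univ (mem_univ _) (mem_univ _))

/-- Near every point there is a lift `F` with `F' = (w - z)^m G` and `G z` independent of `F z`. -/
lemma IsNormalizedLiftAt.exists_deriv_eq_pow_smul (hF : IsNormalizedLiftAt f ℓ F z)
    (hnc : ¬ ∀ᶠ w in 𝓝 z, f w = f z) :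
    ∃ (m : ℕ) (G : ℂ → V), AnalyticAt ℂ G z ∧ G z ≠ 0 ∧ ℓ (G z) = 0 ∧
      ∀ᶠ w in 𝓝 z, deriv F w = (w - z) ^ m • G w := by
  obtain ⟨m, G, hG, hG0, heq⟩ := (hF.analyticAt_deriv.exists_eventuallyEq_pow_smul_nonzero_iff).2
    (fun h => hnc (hF.eventually_const_iff.2 h))
  refine ⟨m, G, hG, hG0, ?_, heq⟩
  -- Since ℓ(F') = 0, also ℓ(G) = 0 off z, hence at z by continuity. With ℓ(F z) = 1 this makes G z
  -- nonzero modulo F z.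
  have hc : ContinuousAt (fun w => ℓ (G w)) z := ℓ.continuous.continuousAt.comp hG.continuousAt
  have h1 : ∀ᶠ w in 𝓝[≠] z, ℓ (G w) = 0 := by
    rw [eventually_nhdsWithin_iff]
    filter_upwards [heq, hF.eventually] with w h1 h2 h3
    have h4 := h2.apply_deriv
    rw [h1, map_smul, smul_eq_mul, mul_eq_zero] at h4
    exact h4.resolve_left (pow_ne_zero _ (sub_ne_zero.2 h3))
  have h2 : Tendsto (fun w => ℓ (G w)) (𝓝[≠] z) (𝓝 (ℓ (G z))) :=
    hc.tendsto.mono_left nhdsWithin_le_nhds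
  exact tendsto_nhds_unique (h2.congr' h1) tendsto_const_nhds

end Lifts

end PeriodCurve

namespace PeriodCurve

variable {V : Type*} [NormedAddCommGroup V] [NormedSpace ℂ V]
variable {h : SesqForm V} {f : ℂ → ℙ ℂ V} {ℓ : V →L[ℂ] ℂ} {F : ℂ → V} {z : ℂ}

lemma IsNormalizedLiftAt.apply_self_ne_zero (hF : IsNormalizedLiftAt f ℓ F z)
    (hfΩ : ∀ z, f z ∈ positiveDomain h) : h (F z) (F z) ≠ 0 := by
  intro h0
  have := hfΩ z (F z) hF.mem_submodule.self_of_nhds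
    (ne_zero_of_apply_eq_one hF.apply_eq_one.self_of_nhds)
  rw [h0] at this
  simp at this

variable [FiniteDimensional ℂ V]

/-! ## Derivatives of the curvature form along a curve -/

lemma contDiffAt_curvForm {n : WithTop ℕ∞} {F A B : ℂ → V} {z : ℂ} (hF : ContDiffAt ℝ n F z)
    (hA : ContDiffAt ℝ n A z) (hB : ContDiffAt ℝ n B z) (h0 : h (F z) (F z) ≠ 0) :
    ContDiffAt ℝ n (fun w => curvForm h (F w) (A w) (B w)) z := by
  have h1 := h.contDiffAt hF hF
  have h2 := h.contDiffAt hA hF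
  have h3 := h.contDiffAt hF hB
  have h4 := h.contDiffAt hA hB
  unfold curvForm
  exact contDiffAt_const.mul (((h4.mul h1).sub (h2.mul h3)).mul ((h1.pow 2).inv (pow_ne_zero 2 h0)))

lemma continuousAt_curvForm {F A B : ℂ → V} {z : ℂ} (hF : ContinuousAt F z)
    (hA : ContinuousAt A z) (hB : ContinuousAt B z) (h0 : h (F z) (F z) ≠ 0) :
    ContinuousAt (fun w => curvForm h (F w) (A w) (B w)) z := by
  have h1 := h.continuousAt hF hF
  have h2 := h.continuousAt hA hF
  have h3 := h.continuousAt hF hB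
  have h4 := h.continuousAt hA hB
  unfold curvForm
  exact continuousAt_const.mul (((h4.mul h1).sub (h2.mul h3)).div (h1.pow 2) (pow_ne_zero 2 h0))

/-- The vector paired with B in the (1,0)-derivative represents, modulo F, the Chern covariant
derivative of the class of A; the (0,1)-derivative is its mirror image by hermitian symmetry. -/
lemma hasWirtinger_curvForm (hh : IsHermitianForm h) {F A B : ℂ → V} {F' A' B' : V} {z : ℂ}
    (hF : HasDerivAt F F' z) (hA : HasDerivAt A A' z) (hB : HasDerivAt B B' z)
    (h0 : h (F z) (F z) ≠ 0) :
    HasWirtinger (fun w => curvForm h (F w) (A w) (B w))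
      (curvForm h (F z) (A' - (h F' (F z) / h (F z) (F z)) • A z -
        (h (A z) (F z) / h (F z) (F z)) • F') (B z))
      (curvForm h (F z) (A z) (B' - (h F' (F z) / h (F z) (F z)) • B z -
        (h (B z) (F z) / h (F z) (F z)) • F')) z := by
  have h1 := h.hasWirtinger hF hF
  have h2 := h.hasWirtinger hA hF
  have h3 := h.hasWirtinger hF hB
  have h4 := h.hasWirtinger hA hB
  have h5 := (((h4.mul h1).sub (h2.mul h3)).div (h1.mul h1) (mul_ne_zero h0 h0)).const_mul (-2)
  refine (h5.congr_of_eventuallyEq (Eventually.of_forall fun w => ?_)).congr ?_ ?_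
  · simp only [curvForm, pow_two]
  · simp only [curvForm, map_sub, map_smul, LinearMap.sub_apply, LinearMap.smul_apply, smul_eq_mul]
    field_simp
    ring
  · simp only [curvForm, map_sub, LinearMap.map_smulₛₗ, smul_eq_mul, map_div₀, hh _ _]
    field_simp
    ring

/-! ## Geometry of an entire curve -/

lemma IsNormalizedLiftAt.omega_eq (hF : IsNormalizedLiftAt f ℓ F z) (hh : IsHermitianForm h)
    (hfΩ : ∀ z, f z ∈ positiveDomain h) (a b : V) :
    omega h (f z) (tanOf (f z) ℓ a) (tanOf (f z) ℓ b) = curvForm h (F z) a b :=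
  omega_tanOf hh (hfΩ z) hF.mem_submodule.self_of_nhds hF.apply_eq_one.self_of_nhds a b

lemma isLineSectionAt_smul_velocity (hf : IsHolomorphicCurve f) (c : ℂ) (z : ℂ) :
    IsLineSectionAt f (fun w => c • velocity f w) z := by
  obtain ⟨ℓ, F, hF⟩ := hf.exists_normalizedLift z
  refine ⟨hF.isHolSectionAt_iff.2 ⟨fun w => c • deriv F w, hF.analyticAt_deriv.const_smul, ?_⟩,
    Eventually.of_forall fun w => Submodule.smul_mem _ _ (Submodule.mem_span_singleton_self _)⟩
  filter_upwards [hF.eventually] with w hw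
  rw [hw.velocity_eq, tanOf_smul]

lemma velocity_mem_tangentLine (hf : IsHolomorphicCurve f) (z : ℂ) :
    velocity f z ∈ tangentLine f z :=
  Submodule.subset_span ⟨_, isLineSectionAt_smul_velocity hf 1 z, one_smul _ _⟩

/-- The squared length of the velocity of `f`. -/
noncomputable def speedSq (h : SesqForm V) (f : ℂ → ℙ ℂ V) (z : ℂ) : ℝ :=
  (omega h (f z) (velocity f z) (velocity f z)).re

lemma IsNormalizedLiftAt.speedSq_eq (hF : IsNormalizedLiftAt f ℓ F z) (hh : IsHermitianForm h)
    (hfΩ : ∀ z, f z ∈ positiveDomain h) :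
    (speedSq h f z : ℂ) = curvForm h (F z) (deriv F z) (deriv F z) := by
  rw [speedSq, hF.velocity_eq, hF.omega_eq hh hfΩ, ofReal_re_curvForm hh]

lemma speedSq_pos (hf : IsHolomorphicCurve f) (hfpos : IsTangentToPositive h f)
    (hz : velocity f z ≠ 0) : 0 < speedSq h f z :=
  hfpos z _ (velocity_mem_tangentLine hf z) hz

lemma speedSq_eq_zero (hf : IsHolomorphicCurve f) (hh : IsHermitianForm h)
    (hfΩ : ∀ z, f z ∈ positiveDomain h) (hz : velocity f z = 0) : speedSq h f z = 0 := by
  obtain ⟨ℓ, F, hF⟩ := hf.exists_normalizedLift z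
  have h0 : velocity f z = tanOf (f z) ℓ 0 := by
    rw [hz]; ext x; simp [tanOf]
  rw [speedSq, h0, hF.omega_eq hh hfΩ]
  simp [curvForm]

lemma speedSq_nonneg (hf : IsHolomorphicCurve f) (hh : IsHermitianForm h)
    (hfΩ : ∀ z, f z ∈ positiveDomain h) (hfpos : IsTangentToPositive h f) (z : ℂ) :
    0 ≤ speedSq h f z := by
  by_cases hz : velocity f z = 0
  · exact (speedSq_eq_zero hf hh hfΩ hz).ge
  · exact (speedSq_pos hf hfpos hz).le

lemma contDiff_speedSq (hf : IsHolomorphicCurve f) (hh : IsHermitianForm h)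
    (hfΩ : ∀ z, f z ∈ positiveDomain h) : ContDiff ℝ 2 (speedSq h f) := by
  have : CompleteSpace V := FiniteDimensional.complete ℂ V
  rw [contDiff_iff_contDiffAt]
  intro z
  obtain ⟨ℓ, F, hF⟩ := hf.exists_normalizedLift z
  have h1 : ContDiffAt ℝ 2 F z := hF.analyticAt.contDiffAt.restrict_scalars ℝ
  have h2 : ContDiffAt ℝ 2 (deriv F) z := hF.analyticAt_deriv.contDiffAt.restrict_scalars ℝ
  have h3 := Complex.reCLM.contDiff.contDiffAt.comp z
    (contDiffAt_curvForm h1 h2 h2 (hF.apply_self_ne_zero hfΩ))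
  refine h3.congr_of_eventuallyEq ?_
  filter_upwards [hF.eventually] with w hw
  simp [← hw.speedSq_eq hh hfΩ]

/-- The curvature identity `∂∂̄ log u = ‖ψ‖² + u` for `u = ω(f', f')`. -/
lemma IsNormalizedLiftAt.curvature_identity (hF : IsNormalizedLiftAt f ℓ F z)
    (hh : IsHermitianForm h) (hfΩ : ∀ z, f z ∈ positiveDomain h) (hf : IsHolomorphicCurve f)
    (hz : speedSq h f z ≠ 0) :
    speedSq h f z * ddbar (speedSq h f) z -
        Complex.normSq (del (fun w => (speedSq h f w : ℂ)) z 1) =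
      speedSq h f z ^ 2 *
        ((orthRatio h (F z) (deriv F z) (deriv (deriv F) z)).re + speedSq h f z) := by
  have : CompleteSpace V := FiniteDimensional.complete ℂ V
  have hd1 : ∀ᶠ w in 𝓝 z, HasDerivAt F (deriv F w) w := by
    filter_upwards [hF.analyticAt.eventually_analyticAt] with w hw
    exact hw.differentiableAt.hasDerivAt
  have hd2 : ∀ᶠ w in 𝓝 z, HasDerivAt (deriv F) (deriv (deriv F) w) w := by
    filter_upwards [hF.analyticAt_deriv.eventually_analyticAt] with w hw
    exact hw.differentiableAt.hasDerivAt
  have hd3 : HasDerivAt (deriv (deriv F)) (deriv (deriv (deriv F)) z) z :=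
    hF.analyticAt_deriv.deriv.differentiableAt.hasDerivAt
  have h00 := hF.apply_self_ne_zero hfΩ
  -- For A = F' the two connection terms coincide, whence the factor 2.
  have hdel : (fun w => del (fun x => (speedSq h f x : ℂ)) w 1) =ᶠ[𝓝 z] fun w =>
      curvForm h (F w) (deriv (deriv F) w) (deriv F w) -
        2 * (h (deriv F w) (F w) / h (F w) (F w) * curvForm h (F w) (deriv F w) (deriv F w)) := by
    filter_upwards [hF.eventually, hF.eventually.eventually_nhds, hd1, hd2] with w h1 h2 h3 h4
    have h5 := hasWirtinger_curvForm hh h3 h4 h4 (h1.apply_self_ne_zero hfΩ)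
    have h6 : (fun x => (speedSq h f x : ℂ)) =ᶠ[𝓝 w] fun x =>
        curvForm h (F x) (deriv F x) (deriv F x) := by
      filter_upwards [h2] with x hx using hx.speedSq_eq hh hfΩ
    rw [(h5.congr_of_eventuallyEq h6).del_eq]
    simp only [curvForm_sub_left, curvForm_smul_left]
    ring
  have hdel' : HasWirtinger (fun x => (speedSq h f x : ℂ)) (del (fun x => (speedSq h f x : ℂ)) z 1)
      ((starRingEnd ℂ) (del (fun x => (speedSq h f x : ℂ)) z 1)) z := by
    have hC := contDiff_speedSq hf hh hfΩ
    exact (HasWirtinger.of_differentiableAt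
      ((contDiff_ofReal_comp hC).differentiable (by simp)).differentiableAt).congr rfl
      (delBar_ofReal (hC.differentiable (by simp)).differentiableAt)
  have hself : (fun x => (speedSq h f x : ℂ)) =ᶠ[𝓝 z] fun x =>
      curvForm h (F x) (deriv F x) (deriv F x) := by
    filter_upwards [hF.eventually] with x hx using hx.speedSq_eq hh hfΩ
  have e1 := hd1.self_of_nhds
  have e2 := hd2.self_of_nhds
  have w11 := hasWirtinger_curvForm hh e1 e2 e2 h00
  have w21 := hasWirtinger_curvForm hh e1 hd3 e2 h00
  have w10 := (h.hasWirtinger e2 e1).div (h.hasWirtinger e1 e1) h00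
  have hbar := ((w21.sub ((w10.mul w11).const_mul 2)).congr_of_eventuallyEq hdel).delBar_eq
  have hU1 : del (fun x => (speedSq h f x : ℂ)) z 1 =
      curvForm h (F z) (deriv (deriv F) z) (deriv F z) -
        2 * (h (deriv F z) (F z) / h (F z) (F z) * curvForm h (F z) (deriv F z) (deriv F z)) :=
    hdel.self_of_nhds
  have hU2 := hdel'.delBar_eq.symm.trans (w11.congr_of_eventuallyEq hself).delBar_eq
  have hcz : (speedSq h f z : ℂ) = curvForm h (F z) (deriv F z) (deriv F z) :=
    hself.self_of_nhds
  -- The ∂̄-derivative of h(F', F)/h(F, F) is -u/2. Multiplied by -2u in the derivative of ∂u it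
  -- yields u², the source of the term u in the identity.
  have hq : (h (deriv F z) (deriv F z) * h (F z) (F z) - h (deriv F z) (F z) * h (F z) (deriv F z)) /
      h (F z) (F z) ^ 2 = -curvForm h (F z) (deriv F z) (deriv F z) / 2 := by
    simp only [curvForm]; ring
  have hc0 : curvForm h (F z) (deriv F z) (deriv F z) ≠ 0 := by
    rw [← hcz]; exact_mod_cast hz
  have hρ : orthRatio h (F z) (deriv F z) (deriv (deriv F) z) *
      curvForm h (F z) (deriv F z) (deriv F z) ^ 2 =
      curvForm h (F z) (deriv (deriv F) z) (deriv (deriv F) z) *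
        curvForm h (F z) (deriv F z) (deriv F z) -
      curvForm h (F z) (deriv (deriv F) z) (deriv F z) *
        curvForm h (F z) (deriv F z) (deriv (deriv F) z) := by
    rw [orthRatio]; field_simp
  have main : (speedSq h f z : ℂ) * delBar (fun w => del (fun x => (speedSq h f x : ℂ)) w 1) z 1 -
      del (fun x => (speedSq h f x : ℂ)) z 1 *
        (starRingEnd ℂ) (del (fun x => (speedSq h f x : ℂ)) z 1) =
      (speedSq h f z : ℂ) ^ 2 *
        (orthRatio h (F z) (deriv F z) (deriv (deriv F) z) + (speedSq h f z : ℂ)) := by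
    rw [hbar, hU2, hU1, hcz, hq]
    simp only [curvForm_sub_right, curvForm_smul_right, map_div₀, hh _ _]
    linear_combination -hρ
  have hre := congrArg Complex.re main
  rw [Complex.mul_conj] at hre
  have e : (speedSq h f z : ℂ) ^ 2 = ((speedSq h f z ^ 2 : ℝ) : ℂ) := by push_cast; rfl
  rw [e, Complex.sub_re, Complex.re_ofReal_mul, Complex.re_ofReal_mul, Complex.add_re,
    Complex.ofReal_re, Complex.ofReal_re] at hre
  exact hre

/-! ## The second fundamental form -/

/-- A section of the tangent line bundle is a smooth multiple of the velocity. -/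
lemma IsNormalizedLiftAt.exists_of_isLineSectionAt (hF : IsNormalizedLiftAt f ℓ F z)
    (hh : IsHermitianForm h) (hfΩ : ∀ z, f z ∈ positiveDomain h)
    (hz : curvForm h (F z) (deriv F z) (deriv F z) ≠ 0) {s : ∀ w, Tan (f w)}
    (hs : IsLineSectionAt f s z) :
    ∃ (A : ℂ → V) (β : ℂ → ℂ), AnalyticAt ℂ A z ∧ (∀ᶠ w in 𝓝 z, s w = tanOf (f w) ℓ (A w)) ∧
      DifferentiableAt ℝ β z ∧
      (∀ b, ∀ B : ℂ → V, ContinuousAt B z → B z = b → ∀ᶠ w in 𝓝 z,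
        curvForm h (F w) (A w) (B w) = β w * curvForm h (F w) (deriv F w) (B w)) := by
  have : CompleteSpace V := FiniteDimensional.complete ℂ V
  obtain ⟨A, hA, hsA⟩ := hF.isHolSectionAt_iff.1 hs.1
  have h00 := hF.apply_self_ne_zero hfΩ
  have hFd := hF.analyticAt.differentiableAt.hasDerivAt
  have hF'd := hF.analyticAt_deriv.differentiableAt.hasDerivAt
  have hAd := hA.differentiableAt.hasDerivAt
  have hβ := ((hasWirtinger_curvForm hh hFd hAd hF'd h00).div
    (hasWirtinger_curvForm hh hFd hF'd hF'd h00) hz).differentiableAt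
  set β : ℂ → ℂ := fun w => curvForm h (F w) (A w) (deriv F w) /
    curvForm h (F w) (deriv F w) (deriv F w) with hβdef
  refine ⟨A, β, hA, hsA, hβ, fun b B hB hBz => ?_⟩
  have hcont : ContinuousAt (fun w => curvForm h (F w) (deriv F w) (deriv F w)) z :=
    continuousAt_curvForm hFd.continuousAt hF'd.continuousAt hF'd.continuousAt h00
  have hne := hcont.eventually_ne hz
  have hpunct : ∀ᶠ w in 𝓝[≠] z,
      curvForm h (F w) (A w) (B w) = β w * curvForm h (F w) (deriv F w) (B w) := by
    filter_upwards [hs.2, nhdsWithin_le_nhds hsA, nhdsWithin_le_nhds hF.eventually,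
      nhdsWithin_le_nhds hne] with w h1 h2 h3 h4
    obtain ⟨κ, hκ⟩ := Submodule.mem_span_singleton.1 h1
    rw [h3.velocity_eq, h2, ← tanOf_smul] at hκ
    obtain ⟨d, hd⟩ := tanOf_eq_tanOf h3.mem_submodule.self_of_nhds h3.apply_eq_one.self_of_nhds
      hκ.symm
    have key : ∀ b, curvForm h (F w) (A w) b = κ * curvForm h (F w) (deriv F w) b := by
      intro b
      rw [hd, curvForm_add_left, curvForm_smul_left, curvForm_smul_left, curvForm_self_left,
        mul_zero, add_zero]
    have hβw : β w = κ := by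
      simp only [hβdef]
      rw [key, mul_div_assoc, div_self h4, mul_one]
    rw [hβw, key]
  have hL : ContinuousAt (fun w => curvForm h (F w) (A w) (B w)) z :=
    continuousAt_curvForm hFd.continuousAt hAd.continuousAt hB h00
  have hR : ContinuousAt (fun w => β w * curvForm h (F w) (deriv F w) (B w)) z :=
    hβ.continuousAt.mul (continuousAt_curvForm hFd.continuousAt hF'd.continuousAt hB h00)
  -- Proportionality to f' is only assumed off z; both sides are continuous at z.
  have hzz : curvForm h (F z) (A z) (B z) = β z * curvForm h (F z) (deriv F z) (B z) :=
    tendsto_nhds_unique ((hL.tendsto.mono_left nhdsWithin_le_nhds).congr' hpunct)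
      (hR.tendsto.mono_left nhdsWithin_le_nhds)
  rw [eventually_nhdsWithin_iff] at hpunct
  filter_upwards [hpunct] with w hw
  by_cases hwz : w = z
  · rw [hwz]; exact hzz
  · exact hw hwz

/-- The covariant derivative of a section of the tangent line bundle. -/
lemma IsNormalizedLiftAt.chernDeriv_eq (hF : IsNormalizedLiftAt f ℓ F z)
    (hh : IsHermitianForm h) (hnd : ∀ x, (∀ y, h x y = 0) → x = 0)
    (hfΩ : ∀ z, f z ∈ positiveDomain h)
    (hz : curvForm h (F z) (deriv F z) (deriv F z) ≠ 0) {s : ∀ w, Tan (f w)}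
    (hs : IsLineSectionAt f s z) :
    ∃ β κ : ℂ, s z = β • velocity f z ∧ chernDeriv h f s z =
      κ • velocity f z + β • tanOf (f z) ℓ (deriv (deriv F) z) := by
  have : CompleteSpace V := FiniteDimensional.complete ℂ V
  obtain ⟨A, β, hA, hsA, hβ, hAβ⟩ := hF.exists_of_isLineSectionAt hh hfΩ hz hs
  have h00 := hF.apply_self_ne_zero hfΩ
  have hm := hF.mem_submodule.self_of_nhds
  have h1 := hF.apply_eq_one.self_of_nhds
  have hFd := hF.analyticAt.differentiableAt.hasDerivAt
  have hF'd := hF.analyticAt_deriv.differentiableAt.hasDerivAt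
  have hβW := HasWirtinger.of_differentiableAt hβ
  -- The covariant derivative of βF' is (∂β)F' + β(F'' - 2(h(F', F)/h(F, F))F'); κ collects the
  -- coefficient of F', which the normal projection later kills.
  set κ : ℂ := del β z 1 - β z * (2 * (h (deriv F z) (F z) / h (F z) (F z))) with hκ
  set E : V := κ • deriv F z + β z • deriv (deriv F) z with hE
  have hdel : ∀ (t : ∀ w, Tan (f w)) (B : ℂ → V), AnalyticAt ℂ B z →
      (∀ᶠ w in 𝓝 z, t w = tanOf (f w) ℓ (B w)) →
      del (fun w => omega h (f w) (s w) (t w)) z 1 = curvForm h (F z) E (B z) := by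
    intro t B hB htB
    have hev : (fun w => omega h (f w) (s w) (t w)) =ᶠ[𝓝 z]
        fun w => β w * curvForm h (F w) (deriv F w) (B w) := by
      filter_upwards [hsA, htB, hF.eventually, hAβ _ B hB.continuousAt rfl] with w e1 e2 e3 e4
      rw [e1, e2, e3.omega_eq hh hfΩ, e4]
    have hW := hβW.mul (hasWirtinger_curvForm hh hFd hF'd hB.differentiableAt.hasDerivAt h00)
    rw [(hW.congr_of_eventuallyEq hev).del_eq, hE, hκ]
    simp only [curvForm_sub_left, curvForm_smul_left, curvForm_add_left]
    ring
  have hspec : ∀ t, IsHolSectionAt f t z → omega h (f z) (chernDeriv h f s z) (t z) =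
      del (fun w => omega h (f w) (s w) (t w)) z 1 := by
    refine Classical.epsilon_spec (p := fun e : Tan (f z) => ∀ t, IsHolSectionAt f t z →
      omega h (f z) e (t z) = del (fun w => omega h (f w) (s w) (t w)) z 1)
      ⟨tanOf (f z) ℓ E, fun t ht => ?_⟩
    obtain ⟨B, hB, htB⟩ := hF.isHolSectionAt_iff.1 ht
    rw [hdel t B hB htB, htB.self_of_nhds, hF.omega_eq hh hfΩ]
  refine ⟨β z, κ, ?_, ?_⟩
  · obtain ⟨d, hd⟩ := eq_smul_of_curvForm_eq_zero hnd h00 (a := A z - β z • deriv F z) fun b => by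
      rw [curvForm_sub_left, curvForm_smul_left, sub_eq_zero]
      exact (hAβ b (fun _ => b) continuousAt_const rfl).self_of_nhds
    have h2 : A z = β z • deriv F z + d • F z := by rw [← hd]; abel
    rw [hsA.self_of_nhds, h2, hF.velocity_eq, tanOf_add, tanOf_smul, tanOf_smul, tanOf_self hm,
      smul_zero, add_zero]
  · obtain ⟨a, ha⟩ := exists_eq_tanOf hm h1 (chernDeriv h f s z)
    -- Uniqueness of the covariant derivative: sections with constant representative b already test
    -- every direction.
    obtain ⟨d, hd⟩ := eq_smul_of_curvForm_eq_zero hnd h00 (a := a - E) fun b => by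
      have hol : IsHolSectionAt f (fun w => tanOf (f w) ℓ b) z :=
        hF.isHolSectionAt_iff.2 ⟨fun _ => b, analyticAt_const, Eventually.of_forall fun _ => rfl⟩
      have h2 := hspec _ hol
      rw [hdel _ (fun _ => b) analyticAt_const (Eventually.of_forall fun _ => rfl), ha,
        hF.omega_eq hh hfΩ] at h2
      rw [curvForm_sub_left, h2, sub_self]
    have h2 : a = E + d • F z := by rw [← hd]; abel
    rw [ha, h2, hE, hF.velocity_eq, tanOf_add, tanOf_add, tanOf_smul, tanOf_smul, tanOf_smul,
      tanOf_self hm, smul_zero, add_zero]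

lemma IsNormalizedLiftAt.tangentLine_eq (hF : IsNormalizedLiftAt f ℓ F z)
    (hf : IsHolomorphicCurve f)
    (hh : IsHermitianForm h) (hnd : ∀ x, (∀ y, h x y = 0) → x = 0)
    (hfΩ : ∀ z, f z ∈ positiveDomain h)
    (hz : curvForm h (F z) (deriv F z) (deriv F z) ≠ 0) :
    tangentLine f z = Submodule.span ℂ {velocity f z} := by
  apply le_antisymm
  · refine Submodule.span_le.2 ?_
    rintro x ⟨s, hs, rfl⟩
    obtain ⟨β, -, hβ, -⟩ := hF.chernDeriv_eq hh hnd hfΩ hz hs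
    rw [hβ]
    exact Submodule.smul_mem _ _ (Submodule.mem_span_singleton_self _)
  · rw [Submodule.span_singleton_le_iff_mem]
    exact velocity_mem_tangentLine hf z

lemma IsNormalizedLiftAt.normalPart_eq (hF : IsNormalizedLiftAt f ℓ F z)
    (hf : IsHolomorphicCurve f)
    (hh : IsHermitianForm h) (hnd : ∀ x, (∀ y, h x y = 0) → x = 0)
    (hfΩ : ∀ z, f z ∈ positiveDomain h)
    (hz : curvForm h (F z) (deriv F z) (deriv F z) ≠ 0) (κ : ℂ) (a : V) :
    normalPart h f z (κ • velocity f z + tanOf (f z) ℓ a) =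
      tanOf (f z) ℓ (a - (curvForm h (F z) a (deriv F z) /
        curvForm h (F z) (deriv F z) (deriv F z)) • deriv F z) := by
  have hm := hF.mem_submodule.self_of_nhds
  have h1 := hF.apply_eq_one.self_of_nhds
  have hL := hF.tangentLine_eq hf hh hnd hfΩ hz
  set q := curvForm h (F z) a (deriv F z) / curvForm h (F z) (deriv F z) (deriv F z) with hq
  have hspec := Classical.epsilon_spec
    (p := fun y : Tan (f z) => κ • velocity f z + tanOf (f z) ℓ a - y ∈ tangentLine f z ∧
      ∀ x ∈ tangentLine f z, omega h (f z) y x = 0)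
    ⟨tanOf (f z) ℓ (a - q • deriv F z), by
      constructor
      · rw [hL, Submodule.mem_span_singleton]
        refine ⟨κ + q, ?_⟩
        rw [tanOf_sub, tanOf_smul, hF.velocity_eq]
        module
      · intro x hx
        rw [hL] at hx
        obtain ⟨c, rfl⟩ := Submodule.mem_span_singleton.1 hx
        rw [hF.velocity_eq, ← tanOf_smul, hF.omega_eq hh hfΩ, curvForm_smul_right,
          curvForm_sub_left, curvForm_smul_left, hq, div_mul_cancel₀ _ hz, sub_self, mul_zero]⟩
  obtain ⟨hy1, hy2⟩ := hspec
  change normalPart h f z (κ • velocity f z + tanOf (f z) ℓ a) = _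
  have hy1' : κ • velocity f z + tanOf (f z) ℓ a -
    normalPart h f z (κ • velocity f z + tanOf (f z) ℓ a) ∈ tangentLine f z := hy1
  have hy2' : ∀ x ∈ tangentLine f z,
    omega h (f z) (normalPart h f z (κ • velocity f z + tanOf (f z) ℓ a)) x = 0 := hy2
  rw [hL] at hy1'
  obtain ⟨c, hc⟩ := Submodule.mem_span_singleton.1 hy1'
  have hy : normalPart h f z (κ • velocity f z + tanOf (f z) ℓ a) =
      tanOf (f z) ℓ (a + (κ - c) • deriv F z) := by
    have h2 : (κ - c) • velocity f z = κ • velocity f z - c • velocity f z := by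
      module
    rw [tanOf_add, tanOf_smul, ← hF.velocity_eq, h2, hc]
    abel
  have h2 := hy2' _ (velocity_mem_tangentLine hf z)
  rw [hy, hF.velocity_eq, hF.omega_eq hh hfΩ, curvForm_add_left, curvForm_smul_left] at h2
  have h3 : κ - c = -q := by
    rw [hq]; field_simp; linear_combination h2
  rw [hy, h3]
  congr 1
  module

/-- The choice of section does not matter: its value at z fixes β, and the rest of its covariant
derivative is a multiple of f', which has no normal part. -/
lemma IsNormalizedLiftAt.psi_smul_velocity (hF : IsNormalizedLiftAt f ℓ F z)
    (hf : IsHolomorphicCurve f)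
    (hh : IsHermitianForm h) (hnd : ∀ x, (∀ y, h x y = 0) → x = 0)
    (hfΩ : ∀ z, f z ∈ positiveDomain h)
    (hz : curvForm h (F z) (deriv F z) (deriv F z) ≠ 0) (c : ℂ) :
    psi h f z (c • velocity f z) = tanOf (f z) ℓ (c • (deriv (deriv F) z -
      (curvForm h (F z) (deriv (deriv F) z) (deriv F z) /
        curvForm h (F z) (deriv F z) (deriv F z)) • deriv F z)) := by
  have hspec : ∃ s, IsLineSectionAt f s z ∧ s z = c • velocity f z ∧
      psi h f z (c • velocity f z) = normalPart h f z (chernDeriv h f s z) :=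
    Classical.epsilon_spec (p := fun y : Tan (f z) => ∃ s, IsLineSectionAt f s z ∧
      s z = c • velocity f z ∧ y = normalPart h f z (chernDeriv h f s z))
      ⟨_, _, isLineSectionAt_smul_velocity hf c z, rfl, rfl⟩
  obtain ⟨s, hs, hsz, hpsi⟩ := hspec
  obtain ⟨β, κ, hβ, hκ⟩ := hF.chernDeriv_eq hh hnd hfΩ hz hs
  have hv0 : velocity f z ≠ 0 := by
    intro h0
    apply hz
    rw [← hF.speedSq_eq hh hfΩ, speedSq_eq_zero hf hh hfΩ h0, Complex.ofReal_zero]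
  have hcβ : β = c := smul_left_injective ℂ hv0 (hβ.symm.trans hsz)
  rw [hpsi, hκ, hcβ, ← tanOf_smul, hF.normalPart_eq hf hh hnd hfΩ hz, curvForm_smul_left]
  congr 1
  module

lemma IsNormalizedLiftAt.psiNormSq_eq (hF : IsNormalizedLiftAt f ℓ F z)
    (hf : IsHolomorphicCurve f)
    (hh : IsHermitianForm h) (hnd : ∀ x, (∀ y, h x y = 0) → x = 0)
    (hfΩ : ∀ z, f z ∈ positiveDomain h)
    (hz : curvForm h (F z) (deriv F z) (deriv F z) ≠ 0) :
    psiNormSq h f z = (orthRatio h (F z) (deriv F z) (deriv (deriv F) z)).re := by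
  have hv0 : velocity f z ≠ 0 := by
    intro h0
    apply hz
    rw [← hF.speedSq_eq hh hfΩ, speedSq_eq_zero hf hh hfΩ h0, Complex.ofReal_zero]
  have hspec : ∃ x ∈ tangentLine f z, x ≠ 0 ∧ psiNormSq h f z =
      (omega h (f z) (psi h f z x) (psi h f z x)).re / (omega h (f z) x x).re :=
    Classical.epsilon_spec (p := fun c : ℝ => ∃ x ∈ tangentLine f z, x ≠ 0 ∧
      c = (omega h (f z) (psi h f z x) (psi h f z x)).re / (omega h (f z) x x).re)
      ⟨_, _, velocity_mem_tangentLine hf z, hv0, rfl⟩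
  obtain ⟨x, hx, hx0, hpsi⟩ := hspec
  rw [hF.tangentLine_eq hf hh hnd hfΩ hz] at hx
  obtain ⟨c, rfl⟩ := Submodule.mem_span_singleton.1 hx
  have hc0 : c ≠ 0 := by
    rintro rfl; simp at hx0
  have hcc : (starRingEnd ℂ) c ≠ 0 := by simpa using hc0
  rw [hpsi, hF.psi_smul_velocity hf hh hnd hfΩ hz, hF.velocity_eq, ← tanOf_smul,
    hF.omega_eq hh hfΩ, hF.omega_eq hh hfΩ]
  rw [← Complex.ofReal_re (_ / _)]
  congr 1
  rw [Complex.ofReal_div, ofReal_re_curvForm hh, ofReal_re_curvForm hh, orthRatio]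
  have hconj : (starRingEnd ℂ) (curvForm h (F z) (deriv F z) (deriv F z)) =
      curvForm h (F z) (deriv F z) (deriv F z) := conj_curvForm hh _ _
  simp only [curvForm_smul_left, curvForm_smul_right, curvForm_sub_left, curvForm_sub_right,
    map_div₀, conj_curvForm hh]
  field_simp
  ring

/-! ## Local structure at the zeros of the velocity -/

/-- Write F' = (w - z)^m G with G z ≠ 0. Then `orthRatio` of G and G' is continuous near z and
agrees with ‖ψ‖² off z. -/
lemma exists_local_model (hf : IsHolomorphicCurve f) (hfnc : ∃ z w, f z ≠ f w)
    (hh : IsHermitianForm h) (hnd : ∀ x, (∀ y, h x y = 0) → x = 0)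
    (hfΩ : ∀ z, f z ∈ positiveDomain h) (hfpos : IsTangentToPositive h f) (z : ℂ) :
    (∀ᶠ w in 𝓝[≠] z, speedSq h f w ≠ 0) ∧ ∃ ρ : ℂ → ℝ, (∀ᶠ w in 𝓝 z, ContinuousAt ρ w) ∧
      ∀ᶠ w in 𝓝[≠] z, psiNormSq h f w = ρ w := by
  have : CompleteSpace V := FiniteDimensional.complete ℂ V
  obtain ⟨ℓ, F, hF⟩ := hf.exists_normalizedLift z
  obtain ⟨m, G, hG, hG0, hℓG, hFG⟩ :=
    hF.exists_deriv_eq_pow_smul (hf.not_eventually_const hfnc z)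
  have hm := hF.mem_submodule.self_of_nhds
  have h1 := hF.apply_eq_one.self_of_nhds
  have h00 := hF.apply_self_ne_zero hfΩ
  have hGline : IsLineSectionAt f (fun w => tanOf (f w) ℓ (G w)) z := by
    refine ⟨hF.isHolSectionAt_iff.2 ⟨G, hG, Eventually.of_forall fun _ => rfl⟩, ?_⟩
    rw [eventually_nhdsWithin_iff]
    filter_upwards [hFG, hF.eventually] with w h2 h3 h4
    have h5 : (w - z) ^ m ≠ 0 := pow_ne_zero _ (sub_ne_zero.2 h4)
    rw [h3.velocity_eq, h2, tanOf_smul]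
    exact Submodule.mem_span_singleton.2 ⟨((w - z) ^ m)⁻¹, by
      rw [smul_smul, inv_mul_cancel₀ h5, one_smul]⟩
  have hGz : tanOf (f z) ℓ (G z) ≠ 0 := by
    intro h2
    rw [← tanOf_self hm] at h2
    obtain ⟨d, hd⟩ := tanOf_eq_tanOf hm h1 h2
    have h3 : (1 + d) = 0 := by
      have := congrArg ℓ hd
      rw [hℓG, map_add, map_smul, h1] at this
      simpa using this.symm
    apply hG0
    rw [hd]
    have : F z + d • F z = (1 + d) • F z := by module
    rw [this, h3, zero_smul]
  -- Positivity of ω on ℒ_z is used here even when f' vanishes at z: since ω is indefinite, G z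
  -- could otherwise be isotropic.
  have hcz : curvForm h (F z) (G z) (G z) ≠ 0 := by
    have h2 := hfpos z _ (Submodule.subset_span ⟨_, hGline, rfl⟩) hGz
    simp only [hF.omega_eq hh hfΩ] at h2
    intro h3
    rw [h3] at h2
    simp at h2
  have hcc : ∀ᶠ w in 𝓝 z, curvForm h (F w) (G w) (G w) ≠ 0 :=
    (continuousAt_curvForm hF.analyticAt.continuousAt hG.continuousAt hG.continuousAt
      h00).eventually_ne hcz
  have hcd : ∀ᶠ w in 𝓝[≠] z, curvForm h (F w) (deriv F w) (deriv F w) ≠ 0 := by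
    rw [eventually_nhdsWithin_iff]
    filter_upwards [hcc, hFG] with w h2 h3 h4
    have h5 : (w - z) ^ m ≠ 0 := pow_ne_zero _ (sub_ne_zero.2 h4)
    have h6 : (starRingEnd ℂ) ((w - z) ^ m) ≠ 0 := (map_ne_zero _).2 h5
    rw [h3, curvForm_smul_left, curvForm_smul_right]
    exact mul_ne_zero h5 (mul_ne_zero h6 h2)
  refine ⟨?_, fun w => (orthRatio h (F w) (G w) (deriv G w)).re, ?_, ?_⟩
  · filter_upwards [hcd, nhdsWithin_le_nhds hF.eventually] with w h2 h3 h4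
    rw [← h3.speedSq_eq hh hfΩ, h4] at h2
    simp at h2
  · filter_upwards [hcc, hF.eventually, hG.eventually_analyticAt] with w h2 h3 h4
    have hFc := h3.analyticAt.continuousAt
    have hGc := h4.continuousAt
    have hG'c := h4.deriv.continuousAt
    have h0 := h3.apply_self_ne_zero hfΩ
    refine Complex.continuous_re.continuousAt.comp ?_
    unfold orthRatio
    exact (((continuousAt_curvForm hFc hG'c hG'c h0).mul
      (continuousAt_curvForm hFc hGc hGc h0)).sub ((continuousAt_curvForm hFc hG'c hGc h0).mul
      (continuousAt_curvForm hFc hGc hG'c h0))).div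
      ((continuousAt_curvForm hFc hGc hGc h0).pow 2) (pow_ne_zero 2 h2)
  · rw [eventually_nhdsWithin_iff] at hcd ⊢
    filter_upwards [hcd, hF.eventually, hFG.eventually_nhds, hG.eventually_analyticAt]
      with w h2 h3 h4 h5 h6
    have h7 : (w - z) ^ m ≠ 0 := pow_ne_zero _ (sub_ne_zero.2 h6)
    have h8 : deriv (deriv F) w = (deriv (fun x => (x - z) ^ m) w) • G w +
        (w - z) ^ m • deriv G w := by
      have h9 : HasDerivAt (fun x => (x - z) ^ m • G x) _ w :=
        HasDerivAt.smul (DifferentiableAt.hasDerivAt (by fun_prop : DifferentiableAt ℂ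
          (fun x : ℂ => (x - z) ^ m) w)) h5.differentiableAt.hasDerivAt
      have h10 : deriv F =ᶠ[𝓝 w] fun x => (x - z) ^ m • G x := h4
      rw [h10.deriv_eq, h9.deriv]
      exact add_comm _ _
    rw [h3.psiNormSq_eq hf hh hnd hfΩ (h2 h6), h8, h4.self_of_nhds, orthRatio_smul_add h7]

/-- ℂ is Lindelöf: countably many neighbourhoods that meet s at most in their centre cover it. -/
lemma countable_of_eventually_nhdsNE {s : Set ℂ} (hs : ∀ z, ∀ᶠ w in 𝓝[≠] z, w ∉ s) :
    s.Countable := by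
  have h1 : ∀ z, insert z sᶜ ∈ 𝓝 z := fun z => by
    have := hs z
    rw [eventually_nhdsWithin_iff] at this
    filter_upwards [this] with w hw
    by_cases h : w = z
    · exact Or.inl h
    · exact Or.inr (hw h)
  obtain ⟨t, ht, htU⟩ := TopologicalSpace.countable_cover_nhds h1
  refine ht.mono fun x hx => ?_
  have h2 : x ∈ ⋃ z ∈ t, insert z sᶜ := by rw [htU]; trivial
  simp only [mem_iUnion] at h2
  obtain ⟨z, hz, h3⟩ := h2
  rcases h3 with rfl | h3
  · exact hz
  · exact absurd hx h3

lemma locallyIntegrable_of_eventually_eq {ρ : ℂ → ℝ}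
    (hρ : ∀ z, ∃ ρ' : ℂ → ℝ, (∀ᶠ w in 𝓝 z, ContinuousAt ρ' w) ∧ ∀ᶠ w in 𝓝[≠] z, ρ w = ρ' w) :
    LocallyIntegrable ρ := by
  intro z
  obtain ⟨ρ', hc, he⟩ := hρ z
  rw [eventually_nhdsWithin_iff] at he
  obtain ⟨r, hr, hball⟩ := Metric.eventually_nhds_iff_ball.1 (hc.and he)
  have hsub : Metric.closedBall z (r / 2) ⊆ Metric.ball z r :=
    Metric.closedBall_subset_ball (by linarith)
  refine ⟨Metric.closedBall z (r / 2), Metric.closedBall_mem_nhds z (by positivity), ?_⟩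
  have hI : IntegrableOn ρ' (Metric.closedBall z (r / 2)) :=
    ContinuousOn.integrableOn_compact (isCompact_closedBall _ _)
      fun w hw => (hball w (hsub hw)).1.continuousWithinAt
  refine hI.congr ?_
  have hne : ∀ᵐ w : ℂ, w ≠ z := by
    rw [ae_iff]
    simp
  filter_upwards [ae_restrict_of_ae hne, ae_restrict_mem Metric.isClosed_closedBall.measurableSet]
    with w h1 h2
  exact ((hball w (hsub h2)).2 h1).symm

/-! ### Finite dimension and nondegeneracy from the signature -/

lemma HasSignature.finiteDimensional {V : Type*} [NormedAddCommGroup V] [NormedSpace ℂ V]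
    {k : SesqForm V} {m p : ℕ} (hk : HasSignature k m p) : FiniteDimensional ℂ V := by
  obtain ⟨-, b, -⟩ := hk
  exact Module.Finite.of_basis b

lemma HasSignature.eq_zero {V : Type*} [NormedAddCommGroup V] [NormedSpace ℂ V]
    {k : SesqForm V} {m p : ℕ} (hk : HasSignature k m p) (x : V) (hx : ∀ y, k x y = 0) :
    x = 0 := by
  obtain ⟨-, b, h1, h2, h3⟩ := hk
  have hb : ∀ i, k (b i) (b i) ≠ 0 := by
    rintro (i | j)
    · rw [h1]; exact one_ne_zero
    · rw [h2]; exact neg_ne_zero.2 one_ne_zero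
  refine b.ext_elem fun i => ?_
  have h4 := hx (b i)
  rw [← b.sum_repr x, map_sum, LinearMap.sum_apply, Finset.sum_eq_single i] at h4
  · rw [map_smul, LinearMap.smul_apply, smul_eq_mul, mul_eq_zero] at h4
    simpa using h4.resolve_right (hb i)
  · intro j _ hj
    rw [map_smul, LinearMap.smul_apply, h3 j i hj, smul_zero]
  · simp

end PeriodCurve

/- The curvature identity already excludes characteristic functions bounded from below; the
comparison with the Fubini-Study metric is not used. -/
theorem corollary6p16 {V : Type*} [NormedAddCommGroup V] [NormedSpace ℂ V] (p : ℕ)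
    (h : PeriodCurve.SesqForm V) (hh : PeriodCurve.HasSignature h 3 p)
    (hFS : PeriodCurve.SesqForm V) (hhFS : PeriodCurve.IsPosDefHermitian hFS)
    (f : ℂ → Projectivization ℂ V) (hf : PeriodCurve.IsHolomorphicCurve f)
    (hfΩ : ∀ z, f z ∈ PeriodCurve.positiveDomain h)
    (hfnc : ∃ z w, f z ≠ f w)
    (hfpos : PeriodCurve.IsTangentToPositive h f)
    (ε : ℝ) (hε : 0 < ε)
    (hfε : ∀ z, ε * (PeriodCurve.omegaFS hFS (f z) (PeriodCurve.velocity f z)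
        (PeriodCurve.velocity f z)).re ≤
      (PeriodCurve.omega h (f z) (PeriodCurve.velocity f z) (PeriodCurve.velocity f z)).re) :
    ¬ BddBelow (PeriodCurve.charSigma h f '' Set.Ici 1) := by
  have := hh.finiteDimensional
  have hherm := hh.1
  have hnd := hh.eq_zero
  have hloc := PeriodCurve.exists_local_model hf hfnc hherm hnd hfΩ hfpos
  refine PeriodCurve.not_bddBelow_characteristic (u := PeriodCurve.speedSq h f)
    (PeriodCurve.contDiff_speedSq hf hherm hfΩ)
    (PeriodCurve.speedSq_nonneg hf hherm hfΩ hfpos)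
    (PeriodCurve.countable_of_eventually_nhdsNE fun z => (hloc z).1)
    (PeriodCurve.locallyIntegrable_of_eventually_eq fun z => (hloc z).2) fun z hz => ?_
  obtain ⟨ℓ, F, hF⟩ := hf.exists_normalizedLift z
  have hcz : PeriodCurve.curvForm h (F z) (deriv F z) (deriv F z) ≠ 0 := by
    rw [← hF.speedSq_eq hherm hfΩ]
    exact_mod_cast hz
  rw [hF.curvature_identity hherm hfΩ hf hz, hF.psiNormSq_eq hf hherm hnd hfΩ hcz]
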